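/- Let $M$ be a smooth manifold of dimension $2n+1$ with a contact metric structure $(\eta,g,\phi)$ and Reeb field $\xi$: $\eta$ is a 1-form with $\eta\wedge(d\eta)^n\neq 0$ everywhere, $\eta(\xi)=1$, $d\eta(\xi,\cdot)=0$, $g$ is a Riemannian metric with $g(X,\xi)=\eta(X)$, and $\phi$ is a $(1,1)$-tensor field with $\phi^2=-I+\eta\otimes\xi$ and $d\eta(X,Y)=g(X,\phi Y)$. Here $d\eta$ is normalized by $2\,d\eta(X,Y)=X(\eta(Y))-Y(\eta(X))-\eta([X,Y])$, and all curvature tensors are those of Levi-Civita connections, with $R(X,Y)Z=\nabla_X\nabla_YZ-\nabla_Y\nabla_XZ-\nabla_{[X,Y]}Z$. For $t\in\mathbb{R}$ put $\eta_t=e^{2t}\eta$, $\xi_t=e^{-2t}\xi$, $g_t=e^{2t}g+e^{2t}(e^{2t}-1)\,\eta\otimes\eta$ and $h_t=\tfrac12\mathcal{L}_{\xi_t}\phi$; let $R^t$ be the curvature of the slice $M_t=(M\times\{t\},g_t)$. The metric symplectization of $M$ is $M\times\mathbb{R}$ with the symplectic form $\omega=d(e^{2t}\eta)$, the metric $\bar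 g=g_t+dt^2$, and the almost complex structure $J$ that equals $\phi$ on $\ker\eta$ and satisfies $J\xi_t=\partial_t$, $J\partial_t=-\xi_t$ (so that $\omega(U,V)=\bar g(U,JV)$). Let $\bar R$ be the curvature of $\bar g$, let $\mathcal{V}$ be the projection of a tangent vector of $M\times\mathbb{R}$ at $(x,t)$ to the tangent space $T_xM$ of the slice, and let $\mathcal{H}$ be the projection to the orthogonal line spanned by $\partial_t$. Then for all $x\in M$, $t\in\mathbb{R}$ and $X,Y,Z\in T_xM$, regarded also as vectors tangent to the slice at $(x,t)$: $$\mathcal{V}(\bar R(X,Y)Z)=R^t(X,Y)Z+g_t(X+\eta_t(X)\xi_t,Z)\,Y-g_t(Y+\eta_t(Y)\xi_t,Z)\,X+g_t(\eta_t(Y)X-\eta_t(X)Y,Z)\,\xi_t,$$ $$\mathcal{H}(\bar R(X,Y)Z)=\bigl(-g_t(\phi Z,\ \eta_t(Y)X-\eta_t(X)Y+\eta_t(Y)h_tX-\eta_t(X)h_tY)+2\eta_t(Z)\,g_t(Y,\phi X)\bigr)\,\partial_t,$$ $$\bar g(\bar R(\partial_t,X)\partial_t,Y)=g_t(X,Y)+3\,\eta_t(X)\eta_t(Y),$$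 $$\bar g(\bar R(X,Y)\partial_t,\partial_t)=0.$$ -/

import Mathlib

open scoped Manifold ContDiff

noncomputable section

/-! ### Tensor calculus in charts

A vector in `TangentSpace I x` is, by Mathlib's construction, an element of the model vector space
`E`, namely the coordinate vector in the preferred chart `extChartAt I x` around `x`.  The exterior
derivative, the Lie derivative and the curvature at `x` are given by their classical coordinate
formulas in this chart.  They are used for manifolds without boundary. -/

section Charts

variable {E : Type*} [NormedAddCommGroup E] [NormedSpace ℝ E]
  {H : Type*} [TopologicalSpace H] (I : ModelWithCorners ℝ E H)
  {M : Type*} [TopologicalSpace M] [ChartedSpace H M]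

/-- The coordinate frame of the chart around `x` at the point with coordinates `y`: the derivative
at `y` of the inverse chart. -/
def chartFrame (x : M) (y : E) : E →L[ℝ] TangentSpace I ((extChartAt I x).symm y) :=
  mfderiv 𝓘(ℝ, E) I (extChartAt I x).symm y

/-- Coordinate expression of a vector field in the chart around `x`. -/
def chartVectorField (V : (p : M) → TangentSpace I p) (x : M) (y : E) : E :=
  (chartFrame I x y).inverse (V ((extChartAt I x).symm y))

/-- Coordinate expression of a 1-form in the chart around `x`. -/
def chartOneForm (α : (p : M) → TangentSpace I p →L[ℝ] ℝ) (x : M) (y : E) : E →L[ℝ] ℝ :=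
  (α ((extChartAt I x).symm y)).comp (chartFrame I x y)

/-- Coordinate expression of a (1,1)-tensor field in the chart around `x`. -/
def chartEndo (φ : (p : M) → TangentSpace I p →L[ℝ] TangentSpace I p) (x : M) (y : E) :
    E →L[ℝ] E :=
  (chartFrame I x y).inverse.comp ((φ ((extChartAt I x).symm y)).comp (chartFrame I x y))

/-- Coordinate expression `(gᵢⱼ)` of a field of bilinear forms in the chart around `x`. -/
def chartBilin (g : (p : M) → TangentSpace I p →L[ℝ] TangentSpace I p →L[ℝ] ℝ) (x : M) (y : E) :
    E →L[ℝ] E →L[ℝ] ℝ :=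
  ContinuousLinearMap.bilinearComp (E := E) (F := E) (g ((extChartAt I x).symm y))
    (chartFrame I x y) (chartFrame I x y)

/-- Exterior derivative of a 1-form, in the normalization with the factor one half:
`2 dα(X, Y) = X(α(Y)) - Y(α(X)) - α([X, Y])`. -/
def extDerivOneForm (α : (p : M) → TangentSpace I p →L[ℝ] ℝ) (x : M) (u v : TangentSpace I x) : ℝ :=
  let D : E →L[ℝ] E →L[ℝ] ℝ := fderiv ℝ (chartOneForm I α x) (extChartAt I x x)
  (1 / 2) * (D u v - D v u)

/-- Lie derivative `L_V φ` of a (1,1)-tensor field along a vector field, evaluated on a tangent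
vector; in coordinates `(L_V φ) u = (∂_V φ) u - (∂_{φ u} V) + φ (∂_u V)`. -/
def lieDerivEndo (V : (p : M) → TangentSpace I p)
    (φ : (p : M) → TangentSpace I p →L[ℝ] TangentSpace I p) (x : M) (u : TangentSpace I x) :
    TangentSpace I x :=
  let DV : E →L[ℝ] E := fderiv ℝ (chartVectorField I V x) (extChartAt I x x)
  let Dφ : E →L[ℝ] E →L[ℝ] E := fderiv ℝ (chartEndo I φ x) (extChartAt I x x)
  let φx : E →L[ℝ] E := φ x
  Dφ (V x) u - DV (φx u) + φx (DV u)

/-- Christoffel symbols `Γ(u, v) = ½ g⁻¹ (∂_u g(v, ·) + ∂_v g(u, ·) - ∂_· g(u, v))` of a field `G`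
of bilinear forms on a vector space, as a vector-valued bilinear expression at `y`. -/
def christoffel (G : E → E →L[ℝ] E →L[ℝ] ℝ) (y : E) (u v : E) : E :=
  (G y).inverse
    ((1 / 2 : ℝ) • (fderiv ℝ G y u v + fderiv ℝ G y v u - ((fderiv ℝ G y).flip u).flip v))

/-- Riemann curvature tensor `R(X, Y) Z = ∇_X ∇_Y Z - ∇_Y ∇_X Z - ∇_{[X, Y]} Z` of the Levi-Civita
connection of `G` on a vector space, for constant vectors `u, v, w` (so that `∇_u w = Γ(u, w)`). -/
def coordCurvature (G : E → E →L[ℝ] E →L[ℝ] ℝ) (y : E) (u v w : E) : E :=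
  fderiv ℝ (fun z ↦ christoffel G z v w) y u - fderiv ℝ (fun z ↦ christoffel G z u w) y v
    + christoffel G y u (christoffel G y v w) - christoffel G y v (christoffel G y u w)

/-- Riemann curvature tensor `R(u, v) w` at `x` of the Riemannian metric `g`, with the convention
`R(X, Y) Z = ∇_X ∇_Y Z - ∇_Y ∇_X Z - ∇_{[X, Y]} Z`. -/
def riemannCurvature (g : (p : M) → TangentSpace I p →L[ℝ] TangentSpace I p →L[ℝ] ℝ) (x : M)
    (u v w : TangentSpace I x) : TangentSpace I x :=
  coordCurvature (E := E) (chartBilin I g x) (extChartAt I x x) u v w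

/-- The value `(α ∧ (dα)ⁿ)(v₀, …, v₂ₙ)` at `x`, up to a positive constant that depends only on
`n`. -/
def contactVolume (n : ℕ) (α : (p : M) → TangentSpace I p →L[ℝ] ℝ) (x : M)
    (v : Fin (2 * n + 1) → TangentSpace I x) : ℝ :=
  ∑ σ : Equiv.Perm (Fin (2 * n + 1)), ((Equiv.Perm.sign σ : ℤ) : ℝ) * α x (v (σ 0)) *
    ∏ i : Fin n, extDerivOneForm I α x
      (v (σ ⟨2 * (i : ℕ) + 1, by omega⟩)) (v (σ ⟨2 * (i : ℕ) + 2, by omega⟩))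

end Charts

/-! ### Contact metric manifolds -/

/-- A contact metric structure `(η, g, φ)` with Reeb field `ξ` on a smooth manifold `M` of dimension
`2n + 1`. -/
structure ContactMetricStructure (n : ℕ) (E : Type*) [NormedAddCommGroup E] [NormedSpace ℝ E]
    (M : Type*) [TopologicalSpace M] [ChartedSpace E M] [IsManifold 𝓘(ℝ, E) ∞ M] where
  dim_eq : Module.finrank ℝ E = 2 * n + 1
  /-- the contact form -/
  η : (p : M) → TangentSpace 𝓘(ℝ, E) p →L[ℝ] ℝ
  smooth_η : ContMDiff 𝓘(ℝ, E) (𝓘(ℝ, E).prod 𝓘(ℝ, E →L[ℝ] ℝ)) ∞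
    (fun p ↦ Bundle.TotalSpace.mk' (E →L[ℝ] ℝ)
      (E := fun p : M ↦ TangentSpace 𝓘(ℝ, E) p →L[ℝ] ℝ) p (η p))
  contact : ∀ p : M, ∃ v : Fin (2 * n + 1) → TangentSpace 𝓘(ℝ, E) p,
    contactVolume 𝓘(ℝ, E) n η p v ≠ 0
  /-- the Reeb vector field -/
  ξ : (p : M) → TangentSpace 𝓘(ℝ, E) p
  smooth_ξ : ContMDiff 𝓘(ℝ, E) (𝓘(ℝ, E).prod 𝓘(ℝ, E)) ∞
    (fun p ↦ (Bundle.TotalSpace.mk' E p (ξ p) : TangentBundle 𝓘(ℝ, E) M))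
  η_ξ : ∀ p, η p (ξ p) = 1
  dη_ξ : ∀ p (u : TangentSpace 𝓘(ℝ, E) p), extDerivOneForm 𝓘(ℝ, E) η p (ξ p) u = 0
  /-- the Riemannian metric -/
  g : Bundle.ContMDiffRiemannianMetric 𝓘(ℝ, E) ∞ E (fun p : M ↦ TangentSpace 𝓘(ℝ, E) p)
  g_ξ : ∀ p (u : TangentSpace 𝓘(ℝ, E) p), g.inner p u (ξ p) = η p u
  /-- the structure tensor -/
  φ : (p : M) → TangentSpace 𝓘(ℝ, E) p →L[ℝ] TangentSpace 𝓘(ℝ, E) p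
  smooth_φ : ContMDiff 𝓘(ℝ, E) (𝓘(ℝ, E).prod 𝓘(ℝ, E →L[ℝ] E)) ∞
    (fun p ↦ Bundle.TotalSpace.mk' (E →L[ℝ] E)
      (E := fun p : M ↦ TangentSpace 𝓘(ℝ, E) p →L[ℝ] TangentSpace 𝓘(ℝ, E) p) p (φ p))
  φ_φ : ∀ p (u : TangentSpace 𝓘(ℝ, E) p), φ p (φ p u) = -u + η p u • ξ p
  dη_eq : ∀ p (u v : TangentSpace 𝓘(ℝ, E) p),
    extDerivOneForm 𝓘(ℝ, E) η p u v = g.inner p u (φ p v)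

/-! ### The product `M × ℝ` -/

section Product

variable {E : Type*} [NormedAddCommGroup E] [NormedSpace ℝ E]
  {M : Type*} [TopologicalSpace M] [ChartedSpace E M]

/-- The model with corners of `M × ℝ`. -/
abbrev cylinderModel (E : Type*) [NormedAddCommGroup E] [NormedSpace ℝ E] :
    ModelWithCorners ℝ (E × ℝ) (ModelProd E ℝ) :=
  𝓘(ℝ, E).prod 𝓘(ℝ, ℝ)

/-- `dπ₁`, where `π₁` is the projection of `M × ℝ` to `M`. -/
def dFst (q : M × ℝ) : TangentSpace (cylinderModel E) q →L[ℝ] TangentSpace 𝓘(ℝ, E) q.1 :=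
  ContinuousLinearMap.fst ℝ E ℝ

/-- The 1-form `dt`, i.e. `dπ₂` for the projection `π₂` of `M × ℝ` to `ℝ`. -/
def dT (q : M × ℝ) : TangentSpace (cylinderModel E) q →L[ℝ] ℝ :=
  ContinuousLinearMap.snd ℝ E ℝ

/-- A tangent vector of `M` at `x` as a tangent vector of the slice `M × {t}` at `(x, t)`. -/
def sliceLift (x : M) (t : ℝ) (u : TangentSpace 𝓘(ℝ, E) x) :
    TangentSpace (cylinderModel E) ((x, t) : M × ℝ) :=
  ((u, 0) : E × ℝ)

/-- The coordinate vector field `∂ₜ` on `M × ℝ`. -/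
def partialT (q : M × ℝ) : TangentSpace (cylinderModel E) q := ((0, 1) : E × ℝ)

/-- The vertical part of a tangent vector of `M × ℝ`: its component in `ker dπ₂`, the tangent space
of the slice. -/
def vert (q : M × ℝ) (U : TangentSpace (cylinderModel E) q) : TangentSpace (cylinderModel E) q :=
  sliceLift q.1 q.2 (dFst q U)

/-- The horizontal part of a tangent vector of `M × ℝ`: its component along `∂ₜ`. -/
def hor (q : M × ℝ) (U : TangentSpace (cylinderModel E) q) : TangentSpace (cylinderModel E) q :=
  dT q U • partialT q

theorem mfderiv_snd_eq_dT (q : M × ℝ) :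
    mfderiv (cylinderModel E) 𝓘(ℝ, ℝ) (Prod.snd : M × ℝ → ℝ) q = dT q := mfderiv_snd

theorem vert_add_hor (q : M × ℝ) (U : TangentSpace (cylinderModel E) q) :
    vert q U + hor q U = U := by
  have h (u : E) (a : ℝ) : ((u, 0) : E × ℝ) + a • ((0, 1) : E × ℝ) = (u, a) := by simp
  exact h _ _

end Product

/-! ### The metric symplectization -/

namespace ContactMetricStructure

variable {n : ℕ} {E : Type*} [NormedAddCommGroup E] [NormedSpace ℝ E]
  {M : Type*} [TopologicalSpace M] [ChartedSpace E M] [IsManifold 𝓘(ℝ, E) ∞ M]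
  (S : ContactMetricStructure n E M)

/-- The contact form `ηₜ = e²ᵗ η` of the slice `M × {t}`. -/
def sliceForm (t : ℝ) (p : M) : TangentSpace 𝓘(ℝ, E) p →L[ℝ] ℝ := Real.exp (2 * t) • S.η p

/-- The Reeb field `ξₜ = e⁻²ᵗ ξ` of the slice `M × {t}`. -/
def sliceReeb (t : ℝ) (p : M) : TangentSpace 𝓘(ℝ, E) p := Real.exp (-(2 * t)) • S.ξ p

/-- The metric `gₜ = e²ᵗ g + e²ᵗ (e²ᵗ - 1) η ⊗ η` of the slice `M × {t}`. -/
def sliceMetric (t : ℝ) (p : M) : TangentSpace 𝓘(ℝ, E) p →L[ℝ] TangentSpace 𝓘(ℝ, E) p →L[ℝ] ℝ :=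
  Real.exp (2 * t) • S.g.inner p +
    (Real.exp (2 * t) * (Real.exp (2 * t) - 1)) • (S.η p).smulRight (S.η p)

/-- The tensor `hₜ = ½ L_{ξₜ} φ` of the slice `M × {t}`. -/
def sliceH (t : ℝ) (p : M) (u : TangentSpace 𝓘(ℝ, E) p) : TangentSpace 𝓘(ℝ, E) p :=
  (1 / 2 : ℝ) • lieDerivEndo 𝓘(ℝ, E) (S.sliceReeb t) S.φ p u

/-- The curvature `Rᵗ` of the slice `(M × {t}, gₜ)`. -/
def sliceCurvature (t : ℝ) (p : M) (u v w : TangentSpace 𝓘(ℝ, E) p) : TangentSpace 𝓘(ℝ, E) p :=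
  riemannCurvature 𝓘(ℝ, E) (S.sliceMetric t) p u v w

/-- The symplectic form `ω = d(e²ᵗ η)` on `M × ℝ`. -/
def sympForm (q : M × ℝ) (U V : TangentSpace (cylinderModel E) q) : ℝ :=
  extDerivOneForm (cylinderModel E)
    (fun r : M × ℝ ↦ (Real.exp (2 * r.2) • S.η r.1).comp (dFst r)) q U V

/-- The almost complex structure on `M × ℝ`: equal to `φ` on `ker η`, with `J ξₜ = ∂ₜ` and
`J ∂ₜ = -ξₜ`. -/
def sympJ (q : M × ℝ) (U : TangentSpace (cylinderModel E) q) : TangentSpace (cylinderModel E) q :=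
  sliceLift q.1 q.2 (S.φ q.1 (dFst q U) - dT q U • S.sliceReeb q.2 q.1)
    + S.sliceForm q.2 q.1 (dFst q U) • partialT q

/-- The metric `ḡ = gₜ + dt²` of the metric symplectization. -/
def sympMetric (q : M × ℝ) :
    TangentSpace (cylinderModel E) q →L[ℝ] TangentSpace (cylinderModel E) q →L[ℝ] ℝ :=
  ContinuousLinearMap.bilinearComp (E := E) (F := E) (S.sliceMetric q.2 q.1)
      (ContinuousLinearMap.fst ℝ E ℝ) (ContinuousLinearMap.fst ℝ E ℝ)
    + (ContinuousLinearMap.snd ℝ E ℝ).smulRight (ContinuousLinearMap.snd ℝ E ℝ)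

/-- The curvature `R̄` of the metric symplectization `(M × ℝ, ḡ)`. -/
def sympCurvature (q : M × ℝ) (U V W : TangentSpace (cylinderModel E) q) :
    TangentSpace (cylinderModel E) q :=
  riemannCurvature (cylinderModel E) S.sympMetric q U V W

/-! ### Consistency of the definitions -/

theorem chartFrame_cylinder (x : M) (t : ℝ) (y : E)
    (hy : y ∈ (extChartAt 𝓘(ℝ, E) x).target) (s : ℝ) (w : E × ℝ) :
    chartFrame (cylinderModel E) ((x, t) : M × ℝ) (y, s) w = ((chartFrame 𝓘(ℝ, E) x y w.1, w.2) : E × ℝ) := by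
  have h1 : (extChartAt (cylinderModel E) ((x, t) : M × ℝ)).symm
      = Prod.map (extChartAt 𝓘(ℝ, E) x).symm (id : ℝ → ℝ) := by
    rw [extChartAt_prod]; rfl
  unfold chartFrame
  have hd : MDifferentiableAt 𝓘(ℝ, E) 𝓘(ℝ, E) (extChartAt 𝓘(ℝ, E) x).symm y := by
    have := (contMDiffOn_extChartAt_symm (I := 𝓘(ℝ, E)) (n := ∞) x).contMDiffAt
      ((isOpen_extChartAt_target x).mem_nhds hy)
    exact this.mdifferentiableAt (by simp)
  have h2 := mfderiv_prodMap (I := 𝓘(ℝ,E)) (I' := 𝓘(ℝ,ℝ)) (p := (y, s)) hd (mdifferentiableAt_id (I := 𝓘(ℝ,ℝ)) (x := s))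
  have h3 := congrArg (fun f : E × ℝ →L[ℝ] E × ℝ => f w) h2
  simp only [mfderiv_id] at h3
  rw [modelWithCornersSelf_prod, ← chartedSpaceSelf_prod]
  erw [h1]
  refine Eq.trans (b := (((mfderiv 𝓘(ℝ, E) 𝓘(ℝ, E) (extChartAt 𝓘(ℝ, E) x).symm y).prodMap
    (ContinuousLinearMap.id ℝ (TangentSpace 𝓘(ℝ, ℝ) s))) w : E × ℝ)) h3 ?_
  rfl

theorem differentiableAt_chartOneForm (S : ContactMetricStructure n E M) (x : M) :
    DifferentiableAt ℝ (chartOneForm 𝓘(ℝ, E) S.η x) (extChartAt 𝓘(ℝ, E) x x) := by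
  have h := (S.smooth_η x)
  rw [contMDiffAt_hom_bundle (E₂ := Bundle.Trivial M ℝ)] at h
  have h2 := h.2
  have h3 := h2.comp_of_eq (x := extChartAt 𝓘(ℝ, E) x x) ((contMDiffOn_extChartAt_symm (I := 𝓘(ℝ, E)) (n := ∞) x).contMDiffAt
      ((isOpen_extChartAt_target x).mem_nhds (mem_extChartAt_target x))) (by simp)
  have h4 := h3.contDiffAt.differentiableAt (by simp)
  refine h4.congr_of_eventuallyEq ?_
  filter_upwards [(isOpen_extChartAt_target (I := 𝓘(ℝ, E)) x).mem_nhds (mem_extChartAt_target x)] with y hy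
  ext w
  have hs : (extChartAt 𝓘(ℝ, E) x).symm y ∈ (chartAt E x).source := by
    simpa using (extChartAt 𝓘(ℝ, E) x).map_target hy
  simp only [Function.comp_def, ContinuousLinearMap.inCoordinates]
  rw [TangentBundle.symmL_trivializationAt hs]
  have hr := (extChartAt 𝓘(ℝ, E) x).right_inv hy
  have : (chartAt E x) ((chartAt E x).symm y) = y := by simpa using hr
  simp [chartOneForm, chartFrame]
  erw [this]

/-- At the center of a chart, coordinates in that chart are the identification of the tangent space
with the model vector space. -/
theorem chartFrame_center (x : M) (w : E) :
    chartFrame 𝓘(ℝ, E) x (extChartAt 𝓘(ℝ, E) x x) w = w := by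
  have hs : x ∈ (chartAt E x).source := by simp
  have h := TangentBundle.symmL_trivializationAt (I := 𝓘(ℝ, E)) (𝕜 := ℝ) hs
  have h' := TangentBundle.symmL_trivializationAt_eq_core (I := 𝓘(ℝ, E)) (𝕜 := ℝ) hs
  rw [h'] at h
  have h2 := congrArg (fun f : E →L[ℝ] E => f w) h
  simp only [mfderivWithin_univ, modelWithCornersSelf_coe, Set.range_id] at h2
  refine Eq.trans h2.symm ?_
  exact (tangentBundleCore 𝓘(ℝ, E) M).coordChange_self _ x (by simp) w

/-- `ω = e²ᵗ (2 dt ∧ η + dη)`, where `2 dt ∧ η = dt ⊗ η - η ⊗ dt`. -/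
theorem sympForm_apply (S : ContactMetricStructure n E M) (x : M) (t : ℝ) (U V : E × ℝ) :
    S.sympForm ((x, t) : M × ℝ) U V = Real.exp (2 * t) * (extDerivOneForm 𝓘(ℝ, E) S.η x U.1 V.1
      + U.2 * S.η x V.1 - V.2 * S.η x U.1) := by
  unfold ContactMetricStructure.sympForm
  set c := extChartAt 𝓘(ℝ, E) x x with hc
  have hcc : extChartAt (cylinderModel E) ((x, t) : M × ℝ) (x, t) = (c, t) := by
    rw [extChartAt_prod]; rfl
  have hev : chartOneForm (cylinderModel E)
      (fun r : M × ℝ ↦ (Real.exp (2 * r.2) • S.η r.1).comp (dFst r)) ((x, t) : M × ℝ)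
      =ᶠ[nhds (c, t)] fun z : E × ℝ ↦ Real.exp (2 * z.2) •
        (chartOneForm 𝓘(ℝ, E) S.η x z.1).comp (ContinuousLinearMap.fst ℝ E ℝ) := by
    have : (extChartAt 𝓘(ℝ, E) x).target ×ˢ (Set.univ : Set ℝ) ∈ nhds (c, t) :=
      prod_mem_nhds ((isOpen_extChartAt_target (I := 𝓘(ℝ, E)) x).mem_nhds
        (mem_extChartAt_target x)) Filter.univ_mem
    filter_upwards [this] with z hz
    obtain ⟨y, s⟩ := z
    ext w
    · have := chartFrame_cylinder x t y hz.1 s (w, 0)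
      simp only [chartOneForm, ContinuousLinearMap.comp_apply, ContinuousLinearMap.inl_apply]
      erw [this]
      simp only [extChartAt_prod]
      rfl
    · have := chartFrame_cylinder x t y hz.1 s (0, 1)
      simp only [chartOneForm, ContinuousLinearMap.comp_apply, ContinuousLinearMap.inr_apply]
      erw [this]
      simp only [extChartAt_prod]
      rfl
  have hA := (differentiableAt_chartOneForm S x).hasFDerivAt
  rw [← hc] at hA
  set A := fderiv ℝ (chartOneForm 𝓘(ℝ, E) S.η x) c with hAdef
  have hB : HasFDerivAt (fun z : E × ℝ ↦ (chartOneForm 𝓘(ℝ, E) S.η x z.1)) (A.comp (ContinuousLinearMap.fst ℝ E ℝ)) (c, t) :=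
    HasFDerivAt.comp (c,t) (f := Prod.fst) hA (hasFDerivAt_fst)
  have hC := hB.clm_comp (hasFDerivAt_const (ContinuousLinearMap.fst ℝ E ℝ) ((c, t) : E × ℝ))
  have hE : HasFDerivAt (fun z : E × ℝ ↦ Real.exp (2 * z.2)) (Real.exp (2 * t) • ((2:ℝ) • ContinuousLinearMap.snd ℝ E ℝ)) (c, t) :=
    ((hasFDerivAt_snd (𝕜 := ℝ) (E := E) (F := ℝ) (p := (c,t))).const_mul (2:ℝ)).exp
  have hF := (hE.smul hC).congr_of_eventuallyEq hev
  have key : chartOneForm 𝓘(ℝ, E) S.η x c = S.η x := by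
    ext w
    have h := chartFrame_center x w
    simp only [chartOneForm, ContinuousLinearMap.comp_apply]
    rw [← hc] at h
    erw [h]
    rw [hc, extChartAt_to_inv]
    rfl
  unfold extDerivOneForm
  simp only [hcc]
  rw [hF.fderiv]
  simp only [← hc, ← hAdef, key]
  obtain ⟨U1, U2⟩ := U
  obtain ⟨V1, V2⟩ := V
  have e (w : E × ℝ) : ((S.η x : E →L[ℝ] ℝ).comp (ContinuousLinearMap.fst ℝ E ℝ)) w = S.η x w.1 := rfl
  simp
  erw [e, e]
  ring


theorem φ_ξ (x : M) : S.φ x (S.ξ x) = 0 := by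
  have h : S.g.inner x (S.φ x (S.ξ x)) (S.φ x (S.ξ x)) = 0 := by
    have h2 := S.dη_eq x (S.φ x (S.ξ x)) (S.ξ x)
    rw [← h2]
    have h3 := S.dη_ξ x (S.φ x (S.ξ x))
    unfold extDerivOneForm at *
    simp only at *
    linarith
  by_contra hne
  exact (S.g.pos x _ hne).ne' h

theorem η_φ (x : M) (v : TangentSpace 𝓘(ℝ, E) x) : S.η x (S.φ x v) = 0 := by
  have h2 := S.dη_ξ x v
  have h3 := S.g.symm x (S.ξ x) (S.φ x v)
  have h4 := S.dη_eq x (S.ξ x) v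
  have h5 := S.g_ξ x (S.φ x v)
  linarith

/-- The metric `ḡ` is the one that `ω` and `J` determine: `ω(U, V) = ḡ(U, J V)`. -/
theorem sympForm_eq_sympMetric (S : ContactMetricStructure n E M) (q : M × ℝ)
    (U V : TangentSpace (cylinderModel E) q) :
    S.sympForm q U V = S.sympMetric q U (S.sympJ q V) := by
  obtain ⟨x, t⟩ := q
  obtain ⟨u, a⟩ := (U : E × ℝ)
  obtain ⟨v, b⟩ := (V : E × ℝ)
  rw [sympForm_apply]
  have h1 := S.dη_eq x u v
  have hJ : S.sympJ (x, t) ((v, b) : E × ℝ) = ((S.φ x v - b • S.sliceReeb t x, S.sliceForm t x v) : E × ℝ) := by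
    have (p : E) (r : ℝ) : ((p, 0) : E × ℝ) + r • ((0, 1) : E × ℝ) = (p, r) := by simp
    exact this _ _
  have hg (p : TangentSpace 𝓘(ℝ, E) x) (r : ℝ) : S.sympMetric (x, t) ((u, a) : E × ℝ) ((p, r) : E × ℝ) = S.sliceMetric t x u p + a * r := by
    rfl
  have hs (p r : TangentSpace 𝓘(ℝ, E) x) : S.sliceMetric t x p r = Real.exp (2 * t) * S.g.inner x p r
     + Real.exp (2 * t) * (Real.exp (2 * t) - 1) * (S.η x p * S.η x r) := by rfl
  have hηφ := S.η_φ x v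
  erw [hJ, hg, hs]
  have e1 : S.sliceReeb t x = Real.exp (-(2*t)) • S.ξ x := rfl
  have e2 : S.sliceForm t x v = Real.exp (2*t) * S.η x v := rfl
  have e3 : Real.exp (2*t) * Real.exp (-(2*t)) = 1 := by rw [← Real.exp_add]; simp
  have h4 : extDerivOneForm 𝓘(ℝ, E) S.η x u v = S.g.inner x u (S.φ x v) := h1
  rw [e1, e2]
  simp only [map_sub, map_smul, smul_eq_mul, S.η_ξ, hηφ]
  erw [h4]
  simp only [zero_sub, mul_one]
  have h6 : S.g.inner x u (S.ξ x) = S.η x u := S.g_ξ x u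
  erw [h6]
  linear_combination (- b * S.η x u  - b * (Real.exp (2 * t) - 1) * S.η x u) * e3.symm

/-- `J² = -1`. -/
theorem sympJ_sympJ (S : ContactMetricStructure n E M) (q : M × ℝ)
    (U : TangentSpace (cylinderModel E) q) : S.sympJ q (S.sympJ q U) = -U := by
  obtain ⟨x, t⟩ := q
  obtain ⟨u, a⟩ := (U : E × ℝ)
  have hJ (v : TangentSpace 𝓘(ℝ, E) x) (b : ℝ) : S.sympJ (x, t) ((v, b) : E × ℝ)
      = ((S.φ x v - b • S.sliceReeb t x, S.sliceForm t x v) : E × ℝ) := by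
    have (p : E) (r : ℝ) : ((p, 0) : E × ℝ) + r • ((0, 1) : E × ℝ) = (p, r) := by simp
    exact this _ _
  have e1 : S.sliceReeb t x = Real.exp (-(2 * t)) • S.ξ x := rfl
  have e2 (v : TangentSpace 𝓘(ℝ, E) x) : S.sliceForm t x v = Real.exp (2 * t) * S.η x v := rfl
  have e3 : Real.exp (2 * t) * Real.exp (-(2 * t)) = 1 := by rw [← Real.exp_add]; simp
  have h1 (w : TangentSpace 𝓘(ℝ, E) x) : S.φ x (S.φ x w - a • S.sliceReeb t x)
      - S.sliceForm t x w • S.sliceReeb t x = -w := by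
    have h : (Real.exp (2 * t) * S.η x w) • Real.exp (-(2 * t)) • S.ξ x = S.η x w • S.ξ x := by
      rw [smul_smul]
      congr 1
      linear_combination S.η x w * e3
    rw [map_sub, map_smul, e1, map_smul, S.φ_ξ, S.φ_φ, e2, h]
    simp
  have h2 (w : TangentSpace 𝓘(ℝ, E) x) :
      S.sliceForm t x (S.φ x w - a • S.sliceReeb t x) = -a := by
    rw [e2, map_sub, S.η_φ, map_smul, e1, map_smul, S.η_ξ]
    simp only [smul_eq_mul]
    linear_combination (-a) * e3
  exact (congrArg (S.sympJ (x, t)) (hJ u a)).trans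
    ((hJ _ _).trans (Prod.ext (h1 u) (h2 u)))

/-- The vertical and horizontal spaces are orthogonal. -/
theorem sympMetric_vert_hor (S : ContactMetricStructure n E M) (q : M × ℝ)
    (U V : TangentSpace (cylinderModel E) q) : S.sympMetric q (vert q U) (hor q V) = 0 := by
  have h1 : S.sympMetric q (vert q U) (hor q V)
      = S.sliceMetric q.2 q.1 (dFst q U) (dFst q (hor q V)) + 0 * dT q (hor q V) := rfl
  have h2 : dFst q (hor q V) = dT q V • (0 : E) := rfl
  rw [h1, h2, smul_zero]
  erw [map_zero]
  simp

end ContactMetricStructure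

end

open scoped Manifold ContDiff

noncomputable section

set_option maxSynthPendingDepth 3

/-! ### Levi-Civita calculus and contact metric identities in one chart. -/

section CoordinateCalculus

open ContinuousLinearMap Filter
open scoped Topology

variable {E : Type*} [NormedAddCommGroup E] [NormedSpace ℝ E]

/-! The slices $M_t$ are equidistant hypersurfaces of $\bar g=g_t+dt^2$ with unit normal
$\partial_t$. Differentiating $g_t$ gives $\partial_t g_t=2g_t(A\cdot,\cdot)$ with
$A=I+\eta\otimes\xi$. Since $\eta_t\otimes\xi_t=\eta\otimes\xi$, the operator $A$ does not depend on
$t$, and the second fundamental form is $g_t+\eta_t\otimes\eta_t$ up to sign.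

The four formulas are the hypersurface equations for this $A$. The vertical part of $\bar R(X,Y)Z$
is the Gauss equation. The horizontal part is the Codazzi equation: $g_t$ is parallel, so only
$\nabla(\eta_t\otimes\eta_t)$ contributes. The third formula is the Riccati equation, which reduces
to $\bar R(\partial_t,X)\partial_t=A^2X$ because $A$ is constant in $t$, and
$A^2=I+3\eta\otimes\xi$. The fourth is the self-adjointness of the second fundamental form.

Codazzi is where the contact geometry enters, through $\nabla_X\xi=-\phi X-\phi hX$
(`covariantDeriv_form`). Each slice $(\eta_t,g_t,\phi)$ is again a contact metric structure, a
$D$-homothetic deformation (`deform`), so `codazzi` is proved once for a general structure and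
applied to the slice.

All of this is done in a chart: `christoffel_cylinderMetric` gives the Christoffel symbols of $\bar
g$ in terms of those of $g_t$ and $A$, and `localContactMetric` supplies the coordinate form of the
structure. -/

theorem isInvertible_of_nondegenerate [FiniteDimensional ℝ E] (B : E →L[ℝ] E →L[ℝ] ℝ)
    (h : ∀ u, (∀ w, B u w = 0) → u = 0) : B.IsInvertible := by
  have hinj : Function.Injective (B : E →ₗ[ℝ] (E →L[ℝ] ℝ)) := by
    rw [injective_iff_map_eq_zero]
    exact fun u hu ↦ h u fun w ↦ DFunLike.congr_fun hu w
  have hdim : Module.finrank ℝ E = Module.finrank ℝ (E →L[ℝ] ℝ) := by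
    rw [← (LinearMap.toContinuousLinearMap (𝕜 := ℝ) (E := E) (F' := ℝ)).finrank_eq]
    exact Subspace.dual_finrank_eq.symm
  have : FiniteDimensional ℝ (E →L[ℝ] ℝ) :=
    Module.Finite.equiv (LinearMap.toContinuousLinearMap (𝕜 := ℝ) (E := E) (F' := ℝ))
  exact ⟨(LinearEquiv.ofInjectiveOfFinrankEq _ hinj hdim).toContinuousLinearEquiv, by ext; rfl⟩

theorem eq_of_forall_bilin_eq {B : E →L[ℝ] E →L[ℝ] ℝ} (hB : B.IsInvertible) {u v : E}
    (h : ∀ w, B u w = B v w) : u = v :=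
  hB.injective (ContinuousLinearMap.ext h)

theorem fderiv_clm_apply_const {F F' : Type*} [NormedAddCommGroup F] [NormedSpace ℝ F]
    [NormedAddCommGroup F'] [NormedSpace ℝ F'] {B : E → F →L[ℝ] F'} {y : E}
    (hB : DifferentiableAt ℝ B y) (p : E) (u : F) :
    fderiv ℝ (fun z ↦ B z u) y p = fderiv ℝ B y p u := by
  rw [(hB.hasFDerivAt.clm_apply (hasFDerivAt_const u y)).fderiv]
  simp

theorem fderiv_bilin_apply_const {F F' F'' : Type*} [NormedAddCommGroup F] [NormedSpace ℝ F]
    [NormedAddCommGroup F'] [NormedSpace ℝ F'] [NormedAddCommGroup F''] [NormedSpace ℝ F'']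
    {B : E → F →L[ℝ] F' →L[ℝ] F''} {y : E}
    (hB : DifferentiableAt ℝ B y) (p : E) (u : F) (v : F') :
    fderiv ℝ (fun z ↦ B z u v) y p = fderiv ℝ B y p u v := by
  rw [fderiv_clm_apply_const (B := fun z ↦ B z u) (hB.clm_apply (differentiableAt_const u)),
    fderiv_clm_apply_const hB]

/-- The device for differentiating an identity of the structure that holds only near the base point.
-/
theorem HasFDerivAt.eq_of_eventuallyEq {F : Type*} [NormedAddCommGroup F] [NormedSpace ℝ F]
    {f g : E → F} {f' g' : E →L[ℝ] F} {y : E} (hf : HasFDerivAt f f' y) (hg : HasFDerivAt g g' y)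
    (h : f =ᶠ[𝓝 y] g) : f' = g' :=
  hf.unique (hg.congr_of_eventuallyEq h)

/-! ### Christoffel symbols -/

/-- The Koszul formula. Invertibility matters because `inverse` takes the default value zero on maps
that are not invertible. -/
theorem christoffel_apply {G : E → E →L[ℝ] E →L[ℝ] ℝ} {y : E} (hG : (G y).IsInvertible)
    (u v w : E) : G y (christoffel G y u v) w
      = (1 / 2) * (fderiv ℝ G y u v w + fderiv ℝ G y v u w - fderiv ℝ G y w u v) := by
  rw [christoffel, hG.self_apply_inverse]
  simp

/-- Uniqueness in the Koszul formula: a guessed symbol can be verified without computing the inverse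
metric. -/
theorem christoffel_eq {G : E → E →L[ℝ] E →L[ℝ] ℝ} {y : E} (hG : (G y).IsInvertible)
    {u v c : E} (h : ∀ w, G y c w
      = (1 / 2) * (fderiv ℝ G y u v w + fderiv ℝ G y v u w - fderiv ℝ G y w u v)) :
    christoffel G y u v = c :=
  eq_of_forall_bilin_eq hG fun w ↦ by rw [h, christoffel_apply hG]

theorem christoffel_congr {G G' : E → E →L[ℝ] E →L[ℝ] ℝ} {y : E} (h : G =ᶠ[𝓝 y] G') (u v : E) :
    christoffel G y u v = christoffel G' y u v := by
  rw [christoffel, christoffel, h.fderiv_eq, h.eq_of_nhds]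

theorem coordCurvature_congr {G G' : E → E →L[ℝ] E →L[ℝ] ℝ} {y : E} (h : G =ᶠ[𝓝 y] G')
    (u v w : E) : coordCurvature G y u v w = coordCurvature G' y u v w := by
  have hΓ (a b : E) : (fun z ↦ christoffel G z a b) =ᶠ[𝓝 y] fun z ↦ christoffel G' z a b :=
    h.eventuallyEq_nhds.mono fun z hz ↦ christoffel_congr hz a b
  simp only [coordCurvature, (hΓ _ _).fderiv_eq, christoffel_congr h]

theorem differentiableAt_christoffel [CompleteSpace E] {G : E → E →L[ℝ] E →L[ℝ] ℝ} {y : E}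
    (hG : ContDiffAt ℝ 2 G y) (hinv : (G y).IsInvertible) (u v : E) :
    DifferentiableAt ℝ (fun z ↦ christoffel G z u v) y := by
  have h1 : DifferentiableAt ℝ (fun z ↦ (G z).inverse) y :=
    ((hinv.contDiffAt_map_inverse (n := 2)).comp y hG).differentiableAt (by simp)
  have h2 : DifferentiableAt ℝ (fderiv ℝ G) y :=
    (hG.fderiv_right (m := 1) (by norm_num)).differentiableAt (by simp)
  have h3 : DifferentiableAt ℝ (fun z ↦ ((fderiv ℝ G z).flip u).flip v) y :=
    (differentiableAt_const (apply ℝ ℝ v)).clm_comp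
      ((differentiableAt_const (apply ℝ (E →L[ℝ] ℝ) u)).clm_comp h2)
  have h4 (a b : E) : DifferentiableAt ℝ (fun z ↦ fderiv ℝ G z a b) y :=
    (h2.clm_apply (differentiableAt_const a)).clm_apply (differentiableAt_const b)
  exact h1.clm_apply ((((h4 u v).add (h4 v u)).sub h3).const_smul (1 / 2 : ℝ))

theorem fderiv_bilin_symm {G : E → E →L[ℝ] E →L[ℝ] ℝ} {y : E}
    (hG : DifferentiableAt ℝ G y)
    (hsymm : ∀ᶠ z in 𝓝 y, ∀ u v, G z u v = G z v u) (p u v : E) :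
    fderiv ℝ G y p u v = fderiv ℝ G y p v u := by
  rw [← fderiv_bilin_apply_const hG, ← fderiv_bilin_apply_const hG]
  have h : (fun z ↦ G z u v) =ᶠ[𝓝 y] fun z ↦ G z v u := hsymm.mono fun z hz ↦ hz u v
  rw [h.fderiv_eq]

/-- Metric compatibility, $\nabla g=0$. -/
theorem fderiv_metric_eq_christoffel {G : E → E →L[ℝ] E →L[ℝ] ℝ} {y : E}
    (hG : DifferentiableAt ℝ G y) (hinv : (G y).IsInvertible)
    (hsymm : ∀ᶠ z in 𝓝 y, ∀ u v, G z u v = G z v u) (u v w : E) :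
    fderiv ℝ G y u v w = G y (christoffel G y u v) w + G y v (christoffel G y u w) := by
  have hD := fderiv_bilin_symm hG hsymm
  rw [hsymm.self_of_nhds v, christoffel_apply hinv, christoffel_apply hinv]
  linear_combination (1 / 2) * hD u v w

theorem christoffel_symm {G : E → E →L[ℝ] E →L[ℝ] ℝ} {y : E}
    (hG : DifferentiableAt ℝ G y) (hsymm : ∀ᶠ z in 𝓝 y, ∀ u v, G z u v = G z v u) (u v : E) :
    christoffel G y u v = christoffel G y v u := by
  unfold christoffel
  congr 2
  ext w
  simp only [add_apply, sub_apply, flip_apply, fderiv_bilin_symm hG hsymm w u v]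
  ring

/-- Pairing a null vector $u$ with $e$ gives $a^2\alpha(u)=0$; the rank-one term then drops out and
$aB(u,\cdot)=0$ remains. -/
theorem isInvertible_deform [FiniteDimensional ℝ E] {B : E →L[ℝ] E →L[ℝ] ℝ} {α : E →L[ℝ] ℝ}
    {e : E} {a : ℝ} (ha : 0 < a) (hB : B.IsInvertible)
    (hα : ∀ u, B u e = α u) (he : α e = 1) :
    (a • B + (a * (a - 1)) • α.smulRight α).IsInvertible := by
  refine isInvertible_of_nondegenerate _ fun u hu ↦ ?_
  simp only [add_apply, smul_apply, smulRight_apply, smul_eq_mul] at hu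
  have h0 : α u = 0 := by
    have := hu e
    rw [hα, he] at this
    have h' : a ^ 2 * α u = 0 := by linear_combination this
    simpa [ha.ne'] using h'
  refine eq_of_forall_bilin_eq hB fun w ↦ ?_
  simpa [h0, ha.ne'] using hu w

/-! ### Contact metric structures in coordinates -/

/-- Near `c`, the coordinate expressions `θ`, `ζ`, `G`, `φ` of a contact form, its Reeb field, a
metric and a (1,1)-tensor field satisfy the identities of a contact metric structure. -/
structure LocalContactMetric (c : E) (θ : E → E →L[ℝ] ℝ) (ζ : E → E)
    (G : E → E →L[ℝ] E →L[ℝ] ℝ) (φ : E → E →L[ℝ] E) : Prop where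
  contDiffAt_form : ContDiffAt ℝ 2 θ c
  contDiffAt_metric : ContDiffAt ℝ 2 G c
  symm : ∀ᶠ y in 𝓝 c, ∀ u v, G y u v = G y v u
  isInvertible : ∀ᶠ y in 𝓝 c, (G y).IsInvertible
  form_reeb : ∀ᶠ y in 𝓝 c, θ y (ζ y) = 1
  fderiv_reeb : ∀ᶠ y in 𝓝 c, ∀ u, fderiv ℝ θ y (ζ y) u = fderiv ℝ θ y u (ζ y)
  metric_reeb : ∀ᶠ y in 𝓝 c, ∀ u, G y u (ζ y) = θ y u
  endo_endo : ∀ᶠ y in 𝓝 c, ∀ u, φ y (φ y u) = -u + θ y u • ζ y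
  fderiv_form : ∀ᶠ y in 𝓝 c, ∀ u v,
    (1 / 2) * (fderiv ℝ θ y u v - fderiv ℝ θ y v u) = G y u (φ y v)

/-- The tensor `½ L_ζ φ` in coordinates. -/
def coordH (ζ : E → E) (φ : E → E →L[ℝ] E) (y u : E) : E :=
  (1 / 2 : ℝ) • (fderiv ℝ φ y (ζ y) u - fderiv ℝ ζ y (φ y u) + φ y (fderiv ℝ ζ y u))

namespace LocalContactMetric

variable {c : E} {θ : E → E →L[ℝ] ℝ} {ζ : E → E} {G : E → E →L[ℝ] E →L[ℝ] ℝ} {φ : E → E →L[ℝ] E}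

theorem form_endo (S : LocalContactMetric c θ ζ G φ) : ∀ᶠ y in 𝓝 c, ∀ u, θ y (φ y u) = 0 := by
  filter_upwards [S.symm, S.metric_reeb, S.fderiv_reeb, S.fderiv_form] with y h1 h2 h3 h4 u
  rw [← h2, h1, ← h4, h3]
  simp

theorem metric_endo (S : LocalContactMetric c θ ζ G φ) :
    ∀ᶠ y in 𝓝 c, ∀ u v, G y u (φ y v) = -G y (φ y u) v := by
  filter_upwards [S.symm, S.fderiv_form] with y h1 h2 u v
  rw [h1 (φ y u), ← h2, ← h2]
  ring

theorem differentiableAt_inverse [CompleteSpace E] (S : LocalContactMetric c θ ζ G φ) :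
    DifferentiableAt ℝ (fun z ↦ (G z).inverse) c :=
  ((S.isInvertible.self_of_nhds.contDiffAt_map_inverse (n := 2)).comp c
    S.contDiffAt_metric).differentiableAt (by simp)

theorem differentiableAt_form (S : LocalContactMetric c θ ζ G φ) : DifferentiableAt ℝ θ c :=
  S.contDiffAt_form.differentiableAt (by simp)

theorem eventually_differentiableAt_form (S : LocalContactMetric c θ ζ G φ) :
    ∀ᶠ y in 𝓝 c, DifferentiableAt ℝ θ y :=
  (S.contDiffAt_form.eventually (by simp)).mono fun _ hy ↦ hy.differentiableAt (by simp)

theorem differentiableAt_metric (S : LocalContactMetric c θ ζ G φ) : DifferentiableAt ℝ G c :=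
  S.contDiffAt_metric.differentiableAt (by simp)

theorem differentiableAt_fderiv_form (S : LocalContactMetric c θ ζ G φ) :
    DifferentiableAt ℝ (fderiv ℝ θ) c :=
  (S.contDiffAt_form.fderiv_right (m := 1) (by norm_num)).differentiableAt (by simp)

/-- The Reeb field is $\theta$ with its index raised by $G$, so its regularity follows from that of
$\theta$ and $G$. The same argument with $d\theta$ in place of $\theta$ handles $\phi$ below. -/
theorem differentiableAt_reeb [CompleteSpace E] (S : LocalContactMetric c θ ζ G φ) :
    DifferentiableAt ℝ ζ c := by
  have h : ζ =ᶠ[𝓝 c] fun y ↦ (G y).inverse (θ y) := by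
    filter_upwards [S.symm, S.isInvertible, S.metric_reeb] with y h1 h2 h3
    have : G y (ζ y) = θ y := ContinuousLinearMap.ext fun u ↦ by rw [h1, h3]
    rw [← this, h2.inverse_apply_self]
  exact (S.differentiableAt_inverse.clm_apply S.differentiableAt_form).congr_of_eventuallyEq h

theorem differentiableAt_endo [CompleteSpace E] (S : LocalContactMetric c θ ζ G φ) :
    DifferentiableAt ℝ φ c := by
  have h : φ =ᶠ[𝓝 c] fun y ↦ (G y).inverse ∘L
      ((1 / 2 : ℝ) • (flipₗᵢ ℝ E E ℝ (fderiv ℝ θ y) - fderiv ℝ θ y)) := by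
    filter_upwards [S.symm, S.isInvertible, S.fderiv_form] with y h1 h2 h3
    ext v
    rw [comp_apply, eq_comm, h2.inverse_apply_eq]
    ext u
    rw [h1, ← h3]
    simp
  have h' := S.differentiableAt_fderiv_form
  refine DifferentiableAt.congr_of_eventuallyEq ?_ h
  exact S.differentiableAt_inverse.clm_comp (by fun_prop)

/-- The `D`-homothetic deformation of a contact metric structure. -/
theorem deform (S : LocalContactMetric c θ ζ G φ) {a : ℝ} (ha : 0 < a)
    [FiniteDimensional ℝ E] :
    LocalContactMetric c (fun y ↦ a • θ y) (fun y ↦ a⁻¹ • ζ y)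
      (fun y ↦ a • G y + (a * (a - 1)) • (θ y).smulRight (θ y)) φ where
  contDiffAt_form := S.contDiffAt_form.const_smul a
  contDiffAt_metric := (S.contDiffAt_metric.const_smul a).add
    ((S.contDiffAt_form.smulRight S.contDiffAt_form).const_smul (a * (a - 1)))
  symm := S.symm.mono fun y hy u v ↦ by
    simp [hy u v, mul_comm (θ y u)]
  isInvertible := by
    filter_upwards [S.isInvertible, S.metric_reeb, S.form_reeb] with y h2 h3 h4
    exact isInvertible_deform ha h2 h3 h4
  form_reeb := S.form_reeb.mono fun y hy ↦ by simp [hy, ha.ne']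
  fderiv_reeb := by
    filter_upwards [S.fderiv_reeb, S.eventually_differentiableAt_form] with y hy h u
    simp [fderiv_fun_const_smul h, hy]
  metric_reeb := by
    filter_upwards [S.metric_reeb, S.form_reeb] with y h1 h2 u
    simp only [add_apply, smul_apply, smulRight_apply, smul_eq_mul, map_smul, h1, h2]
    field_simp
    ring
  endo_endo := S.endo_endo.mono fun y hy u ↦ by
    rw [hy]
    simp [smul_smul, mul_comm, ha.ne']
  fderiv_form := by
    -- Here $\theta\circ\phi=0$ kills the rank-one part of the new metric, so both sides just scale
    -- by $a$ and $\phi$ need not change.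
    filter_upwards [S.fderiv_form, S.form_endo, S.eventually_differentiableAt_form]
      with y h1 h2 h u v
    simp only [add_apply, smul_apply, smulRight_apply, smul_eq_mul, ← h1, h2,
      fderiv_fun_const_smul h]
    ring

variable [CompleteSpace E]

theorem fderiv_form_reeb (S : LocalContactMetric c θ ζ G φ) (p : E) :
    fderiv ℝ θ c p (ζ c) + θ c (fderiv ℝ ζ c p) = 0 := by
  have h := HasFDerivAt.eq_of_eventuallyEq (S.differentiableAt_form.hasFDerivAt.clm_apply
    S.differentiableAt_reeb.hasFDerivAt) (hasFDerivAt_const (1 : ℝ) c) S.form_reeb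
  have := DFunLike.congr_fun h p
  simp at this
  linarith

theorem fderiv_metric_reeb (S : LocalContactMetric c θ ζ G φ) (p u : E) :
    fderiv ℝ G c p u (ζ c) + G c u (fderiv ℝ ζ c p) = fderiv ℝ θ c p u := by
  have hu : HasFDerivAt (fun y ↦ G y u) ((fderiv ℝ G c).flip u) c := by
    simpa using S.differentiableAt_metric.hasFDerivAt.clm_apply (hasFDerivAt_const u c)
  have h := (hu.clm_apply S.differentiableAt_reeb.hasFDerivAt).fderiv
  rw [EventuallyEq.fderiv_eq (f := fun y ↦ θ y u) (S.metric_reeb.mono fun y hy ↦ hy u)] at h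
  have := DFunLike.congr_fun h p
  rw [fderiv_clm_apply_const S.differentiableAt_form] at this
  simp at this
  linarith

theorem fderiv_endo_endo (S : LocalContactMetric c θ ζ G φ) (p u : E) :
    fderiv ℝ φ c p (φ c u) + φ c (fderiv ℝ φ c p u)
      = fderiv ℝ θ c p u • ζ c + θ c u • fderiv ℝ ζ c p := by
  have hu : HasFDerivAt (fun y ↦ φ y u) ((fderiv ℝ φ c).flip u) c := by
    simpa using S.differentiableAt_endo.hasFDerivAt.clm_apply (hasFDerivAt_const u c)
  have hv : HasFDerivAt (fun y ↦ θ y u) ((fderiv ℝ θ c).flip u) c := by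
    simpa using S.differentiableAt_form.hasFDerivAt.clm_apply (hasFDerivAt_const u c)
  have h := HasFDerivAt.eq_of_eventuallyEq (S.differentiableAt_endo.hasFDerivAt.clm_apply hu)
    ((hv.smul S.differentiableAt_reeb.hasFDerivAt).const_add (-u))
    (S.endo_endo.mono fun y hy ↦ hy u)
  have := DFunLike.congr_fun h p
  simp at this
  rw [add_comm (fderiv ℝ φ c p (φ c u)), this, add_comm]

/-- The form `dθ` is invariant under the flow of `ζ`. -/
theorem lieDeriv_fderiv_form (S : LocalContactMetric c θ ζ G φ) (u v : E) :
    fderiv ℝ G c (ζ c) u (φ c v) + G c u (fderiv ℝ φ c (ζ c) v)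
      = -G c (fderiv ℝ ζ c u) (φ c v) - G c u (φ c (fderiv ℝ ζ c v)) := by
  have hD := S.differentiableAt_fderiv_form
  -- Symmetry of second derivatives plays the role of $d^2\theta=0$ in Cartan's formula $L_\zeta
  -- d\theta=d\,\iota_\zeta d\theta+\iota_\zeta d\,d\theta$.
  have hsymm (p q r : E) : fderiv ℝ (fderiv ℝ θ) c p q r = fderiv ℝ (fderiv ℝ θ) c q p r := by
    have := (S.contDiffAt_form.isSymmSndFDerivAt (by simp)).eq p q
    exact DFunLike.congr_fun this r
  have h1 : fderiv ℝ G c (ζ c) u (φ c v) + G c u (fderiv ℝ φ c (ζ c) v)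
      = (1 / 2) * (fderiv ℝ (fderiv ℝ θ) c (ζ c) u v - fderiv ℝ (fderiv ℝ θ) c (ζ c) v u) := by
    have hu : HasFDerivAt (fun y ↦ G y u) ((fderiv ℝ G c).flip u) c := by
      simpa using S.differentiableAt_metric.hasFDerivAt.clm_apply (hasFDerivAt_const u c)
    have hv : HasFDerivAt (fun y ↦ φ y v) ((fderiv ℝ φ c).flip v) c := by
      simpa using S.differentiableAt_endo.hasFDerivAt.clm_apply (hasFDerivAt_const v c)
    have hbil (a b : E) : DifferentiableAt ℝ (fun y ↦ fderiv ℝ θ y a b) c := by fun_prop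
    have h := HasFDerivAt.eq_of_eventuallyEq
      (((hbil u v).hasFDerivAt.sub (hbil v u).hasFDerivAt).const_mul (1 / 2)) (hu.clm_apply hv)
      (S.fderiv_form.mono fun y hy ↦ hy u v)
    have h' := DFunLike.congr_fun h (ζ c)
    simp only [smul_apply, sub_apply, fderiv_bilin_apply_const hD] at h'
    simp at h'
    linarith
  -- The derivative of $\iota_\zeta d\theta=0$ in the direction $p$.
  have h2 (p q : E) : fderiv ℝ (fderiv ℝ θ) c p (ζ c) q + fderiv ℝ θ c (fderiv ℝ ζ c p) q
      = fderiv ℝ (fderiv ℝ θ) c p q (ζ c) + fderiv ℝ θ c q (fderiv ℝ ζ c p) := by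
    have hq : HasFDerivAt (fun y ↦ fderiv ℝ θ y q) ((fderiv ℝ (fderiv ℝ θ) c).flip q) c := by
      simpa using hD.hasFDerivAt.clm_apply (hasFDerivAt_const q c)
    have ha := ((hD.hasFDerivAt.clm_apply S.differentiableAt_reeb.hasFDerivAt).clm_apply
      (hasFDerivAt_const q c))
    have hb := HasFDerivAt.eq_of_eventuallyEq ha
      (hq.clm_apply S.differentiableAt_reeb.hasFDerivAt) (S.fderiv_reeb.mono fun y hy ↦ hy q)
    have h' := DFunLike.congr_fun hb p
    simp at h'
    linarith
  have h3 := S.fderiv_form.self_of_nhds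
  have h4 := S.metric_endo.self_of_nhds
  have h5 := S.symm.self_of_nhds
  rw [h1]
  linear_combination (1 / 2) * (h2 v u) * (-1) + (1 / 2) * h2 u v + h3 v (fderiv ℝ ζ c u)
    - h3 u (fderiv ℝ ζ c v) + h4 v (fderiv ℝ ζ c u) - h5 (φ c v) (fderiv ℝ ζ c u)
    + (1 / 2) * hsymm (ζ c) u v - (1 / 2) * hsymm (ζ c) v u + (1 / 2) * hsymm u v (ζ c)

/-- The covariant derivative of the contact form: `∇ζ = -φ - φ h`. -/
theorem covariantDeriv_form (S : LocalContactMetric c θ ζ G φ) (u w : E) :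
    fderiv ℝ θ c u w - θ c (christoffel G c u w) = -G c (φ c u + φ c (coordH ζ φ c u)) w := by
  -- `L` is $L_\zeta g$. The plan is to split $\nabla\theta$ into its antisymmetric part $d\theta$
  -- and its symmetric part $\frac12L_\zeta g$.
  set L : E → E → ℝ := fun u w ↦
    fderiv ℝ G c (ζ c) u w + G c (fderiv ℝ ζ c u) w + G c u (fderiv ℝ ζ c w) with hL
  have hD := fderiv_bilin_symm S.differentiableAt_metric S.symm
  have hsymm := S.symm.self_of_nhds
  have hLsymm (u w : E) : L u w = L w u := by
    simp only [hL, hD (ζ c) u w, hsymm (fderiv ℝ ζ c u) w, hsymm u (fderiv ℝ ζ c w)]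
    ring
  -- Leibniz rule for $L_\zeta$ applied to $d\theta=g(\cdot,\phi\,\cdot)$, together with $L_\zeta
  -- d\theta=0$.
  have hLφ (u v : E) : L u (φ c v) = -2 * G c u (coordH ζ φ c v) := by
    have h := S.lieDeriv_fderiv_form u v
    simp only [hL, coordH, map_add, map_sub, map_smul, smul_eq_mul]
    linear_combination h
  -- This is $L_\zeta\theta=0$.
  have hζ (u : E) : fderiv ℝ θ c (ζ c) u + θ c (fderiv ℝ ζ c u) = 0 := by
    rw [S.fderiv_reeb.self_of_nhds, S.fderiv_form_reeb]
  have hLζ (u : E) : L u (ζ c) = 0 := by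
    have h1 := S.fderiv_metric_reeb (ζ c) u
    have h2 := S.metric_reeb.self_of_nhds (fderiv ℝ ζ c u)
    simp only [hL]
    linear_combination h1 + h2 + hζ u
  -- $h\phi=-\phi h$, because $L_\zeta(\phi^2)=L_\zeta(-I+\theta\otimes\zeta)=0$.
  have hanti (u : E) : coordH ζ φ c (φ c u) = -φ c (coordH ζ φ c u) := by
    have h1 := S.fderiv_endo_endo (ζ c) u
    have h2 := S.endo_endo.self_of_nhds
    have h3 : fderiv ℝ θ c (ζ c) u • ζ c + θ c (fderiv ℝ ζ c u) • ζ c = 0 := by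
      rw [← add_smul, hζ, zero_smul]
    rw [eq_neg_iff_add_eq_zero]
    simp only [coordH, map_add, map_sub, map_smul, h2, map_neg]
    rw [← smul_add]
    have : fderiv ℝ φ c (ζ c) (φ c u) = fderiv ℝ θ c (ζ c) u • ζ c + θ c u • fderiv ℝ ζ c (ζ c)
      - φ c (fderiv ℝ φ c (ζ c) u) := by rw [← h1]; abel
    rw [this, eq_neg_of_add_eq_zero_left h3]
    convert smul_zero (1 / 2 : ℝ)
    abel
  -- Put $v=\phi u$ in `hLφ`: since `L` annihilates $\zeta$, $\phi^2$ acts as $-1$ inside `L`, and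
  -- anticommutation moves $\phi$ past $h$.
  have hLL (u w : E) : L u w = -2 * G c (φ c (coordH ζ φ c u)) w := by
    have h1 := hLφ w (φ c u)
    have h2 : L w (φ c (φ c u)) = -L w u + θ c u * L w (ζ c) := by
      rw [S.endo_endo.self_of_nhds]
      simp only [hL, map_add, map_neg, map_smul, smul_eq_mul]
      ring
    rw [hLζ, h1, hanti, map_neg] at h2
    rw [hLsymm, hsymm (φ c (coordH ζ φ c u))]
    linarith
  have hN : 2 * (fderiv ℝ θ c u w - θ c (christoffel G c u w))
      = (fderiv ℝ θ c u w - fderiv ℝ θ c w u) + L u w := by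
    have h1 := S.fderiv_metric_reeb u w
    have h2 := S.fderiv_metric_reeb w u
    rw [← S.metric_reeb.self_of_nhds (christoffel G c u w),
      christoffel_apply S.isInvertible.self_of_nhds]
    simp only [hL]
    linear_combination (-1) * h1 + (-1) * h2 - hsymm (fderiv ℝ ζ c u) w
  have h1 := S.fderiv_form.self_of_nhds u w
  have h2 := S.metric_endo.self_of_nhds u w
  have h3 := hLL u w
  rw [map_add, add_apply]
  linear_combination (1 / 2) * hN + h1 + h2 + (1 / 2) * h3

end LocalContactMetric

end CoordinateCalculus

/-! ### Hypersurface equations for a metric $H+dt^2$. -/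

section CylinderCalculus

open ContinuousLinearMap Filter
open scoped Topology

variable {E : Type*} [NormedAddCommGroup E] [NormedSpace ℝ E]

theorem fderiv_prod_left {F : Type*} [NormedAddCommGroup F] [NormedSpace ℝ F] {f : E × ℝ → F}
    {c : E} {t : ℝ} (hf : DifferentiableAt ℝ f (c, t)) (u : E) :
    fderiv ℝ f (c, t) (u, 0) = fderiv ℝ (fun y ↦ f (y, t)) c u := by
  have h := (hf.hasFDerivAt.comp c (hasFDerivAt_prodMk_left (𝕜 := ℝ) c t)).fderiv
  have h' := DFunLike.congr_fun h u
  simpa [Function.comp_def] using h'.symm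

theorem fderiv_prod_right {F : Type*} [NormedAddCommGroup F] [NormedSpace ℝ F] {f : E × ℝ → F}
    {c : E} {t : ℝ} (hf : DifferentiableAt ℝ f (c, t)) (s : ℝ) :
    fderiv ℝ f (c, t) (0, s) = fderiv ℝ (fun r ↦ f (c, r)) t s := by
  have h := (hf.hasFDerivAt.comp t (hasFDerivAt_prodMk_right c t)).fderiv
  have h' := DFunLike.congr_fun h s
  simpa [Function.comp_def] using h'.symm

theorem christoffel_zero_left (G : E → E →L[ℝ] E →L[ℝ] ℝ) (y u : E) :
    christoffel G y 0 u = 0 := by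
  simp [christoffel]

theorem christoffel_zero_right (G : E → E →L[ℝ] E →L[ℝ] ℝ) (y u : E) :
    christoffel G y u 0 = 0 := by
  simp [christoffel]

/-- The metric `H + dt²` on `E × ℝ`, where `H` is a family of metrics on the slices `E × {t}`. -/
def cylinderMetric (H : E × ℝ → E →L[ℝ] E →L[ℝ] ℝ) (z : E × ℝ) : E × ℝ →L[ℝ] E × ℝ →L[ℝ] ℝ :=
  (H z).bilinearComp (fst ℝ E ℝ) (fst ℝ E ℝ) + (snd ℝ E ℝ).smulRight (snd ℝ E ℝ)

variable {H : E × ℝ → E →L[ℝ] E →L[ℝ] ℝ} {z : E × ℝ}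

theorem cylinderMetric_apply (p q : E × ℝ) :
    cylinderMetric H z p q = H z p.1 q.1 + p.2 * q.2 := by
  simp [cylinderMetric]

theorem contDiffAt_cylinderMetric (hH : ContDiffAt ℝ 2 H z) :
    ContDiffAt ℝ 2 (cylinderMetric H) z := by
  have h : ContDiffAt ℝ 2 (fun z ↦ ((compL ℝ (E × ℝ) E ℝ).flip (fst ℝ E ℝ)) ∘L (H z ∘L fst ℝ E ℝ)
      + (snd ℝ E ℝ).smulRight (snd ℝ E ℝ)) z :=
    (contDiffAt_const.clm_comp (hH.clm_comp contDiffAt_const)).add contDiffAt_const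
  refine h.congr_of_eventuallyEq (.of_forall fun z ↦ ?_)
  refine ContinuousLinearMap.ext fun p ↦ ContinuousLinearMap.ext fun q ↦ ?_
  simp [cylinderMetric]

theorem isInvertible_cylinderMetric [FiniteDimensional ℝ E] (hH : (H z).IsInvertible) :
    (cylinderMetric H z).IsInvertible := by
  refine isInvertible_of_nondegenerate _ fun u hu ↦ ?_
  simp only [cylinderMetric_apply] at hu
  refine Prod.ext (eq_of_forall_bilin_eq hH fun w ↦ ?_) ?_
  · simpa using hu (w, 0)
  · simpa using hu (0, 1)

theorem fderiv_cylinderMetric (hH : ContDiffAt ℝ 2 H z) (p q r : E × ℝ) :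
    fderiv ℝ (cylinderMetric H) z p q r = fderiv ℝ H z p q.1 r.1 := by
  have hH' := hH.differentiableAt (by simp)
  rw [← fderiv_bilin_apply_const ((contDiffAt_cylinderMetric hH).differentiableAt (by simp)),
    ← fderiv_bilin_apply_const hH']
  simp only [cylinderMetric_apply, fderiv_add_const]

/-- The Christoffel symbols of `H + dt²`, where `A` is the shape operator of the slices. -/
theorem christoffel_cylinderMetric [FiniteDimensional ℝ E] (hH : ContDiffAt ℝ 2 H z)
    (hinv : (H z).IsInvertible) {A : E →L[ℝ] E}
    (hA : ∀ u v, fderiv ℝ H z (0, 1) u v = 2 * H z (A u) v) (p q : E × ℝ) :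
    christoffel (cylinderMetric H) z p q
      = (christoffel (fun y ↦ H (y, z.2)) z.1 p.1 q.1 + p.2 • A q.1 + q.2 • A p.1,
        -H z (A p.1) q.1) := by
  refine christoffel_eq (isInvertible_cylinderMetric hinv) fun r ↦ ?_
  -- Split the derivative into its slice part and its $\partial_t$ part; the latter is given by the
  -- shape operator.
  have hsplit (u : E × ℝ) (v w : E) : fderiv ℝ H z u v w
      = fderiv ℝ (fun y ↦ H (y, z.2)) z.1 u.1 v w + u.2 * (2 * H z (A v) w) := by
    have h : u = (u.1, 0) + u.2 • (0, 1) := by simp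
    have h' := fderiv_prod_left (c := z.1) (t := z.2) (hH.differentiableAt (by simp)) u.1
    rw [← hA, ← h']
    nth_rw 1 [h]
    rw [map_add, map_smul]
    rfl
  have hΓ := christoffel_apply (G := fun y ↦ H (y, z.2)) (y := z.1) hinv p.1 q.1 r.1
  simp only [fderiv_cylinderMetric hH, cylinderMetric_apply, hsplit, map_add, map_smul, add_apply,
    smul_apply, smul_eq_mul]
  linear_combination hΓ

/-- The family `H` of metrics near `(c, t)` is regular and its slices have the shape operator `A`,
which does not depend on `t`. -/
structure LocalCylinder (c : E) (t : ℝ) (H : E × ℝ → E →L[ℝ] E →L[ℝ] ℝ) (A : E → E →L[ℝ] E) :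
    Prop where
  contDiffAt : ContDiffAt ℝ 2 H (c, t)
  isInvertible : ∀ᶠ z in 𝓝 (c, t), (H z).IsInvertible
  shape : ∀ᶠ z in 𝓝 (c, t), ∀ u v, fderiv ℝ H z (0, 1) u v = 2 * H z (A z.1 u) v

namespace LocalCylinder

variable [FiniteDimensional ℝ E] {c : E} {t : ℝ} {A : E → E →L[ℝ] E}

/-- The formula is needed on a neighbourhood because the curvature differentiates the Christoffel
symbols. -/
theorem eventually_christoffel (S : LocalCylinder c t H A) : ∀ᶠ z in 𝓝 (c, t), ∀ p q,
    christoffel (cylinderMetric H) z p q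
      = (christoffel (fun y ↦ H (y, z.2)) z.1 p.1 q.1 + p.2 • A z.1 q.1 + q.2 • A z.1 p.1,
        -H z (A z.1 p.1) q.1) := by
  filter_upwards [S.contDiffAt.eventually (by simp), S.isInvertible, S.shape] with z h1 h2 h3
  exact christoffel_cylinderMetric h1 h2 h3

theorem differentiableAt_christoffel (S : LocalCylinder c t H A) (p q : E × ℝ) :
    DifferentiableAt ℝ (fun z ↦ christoffel (cylinderMetric H) z p q) (c, t) :=
  haveI := FiniteDimensional.complete ℝ E
  _root_.differentiableAt_christoffel (contDiffAt_cylinderMetric S.contDiffAt)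
    (isInvertible_cylinderMetric S.isInvertible.self_of_nhds) p q

theorem fderiv_christoffel_fst (S : LocalCylinder c t H A) (u v w : E) :
    (fderiv ℝ (fun z ↦ christoffel (cylinderMetric H) z (v, 0) (w, 0)) (c, t) (u, 0)).1
      = fderiv ℝ (fun y ↦ christoffel (fun y ↦ H (y, t)) y v w) c u := by
  have hd := S.differentiableAt_christoffel (v, 0) (w, 0)
  have h := fderiv_prod_left hd.fst u
  rw [(hasFDerivAt_fst.comp (c, t) hd.hasFDerivAt).fderiv (f := fun z ↦ (_ : E × ℝ).1)] at h
  refine h.trans (DFunLike.congr_fun (EventuallyEq.fderiv_eq ?_) u)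
  filter_upwards [(Continuous.prodMk_left t).continuousAt.eventually S.eventually_christoffel]
    with y hy
  simp [hy]

theorem fderiv_christoffel_snd (S : LocalCylinder c t H A) (u v w : E) :
    (fderiv ℝ (fun z ↦ christoffel (cylinderMetric H) z (v, 0) (w, 0)) (c, t) (u, 0)).2
      = -fderiv ℝ (fun y ↦ H (y, t) (A y v) w) c u := by
  have hd := S.differentiableAt_christoffel (v, 0) (w, 0)
  have h := fderiv_prod_left hd.snd u
  rw [(hasFDerivAt_snd.comp (c, t) hd.hasFDerivAt).fderiv (f := fun z ↦ (_ : E × ℝ).2)] at h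
  refine h.trans ((DFunLike.congr_fun (EventuallyEq.fderiv_eq (f := fun y ↦ -(H (y, t) (A y v) w))
    ?_) u).trans (by rw [fderiv_fun_neg]; rfl))
  filter_upwards [(Continuous.prodMk_left t).continuousAt.eventually S.eventually_christoffel]
    with y hy
  simp [hy]

/-- The Gauss equation: the quadratic terms in $A$ arise when the normal component of one
Christoffel symbol is fed into another. -/
theorem coordCurvature_slice_fst (S : LocalCylinder c t H A) (u v w : E) :
    (coordCurvature (cylinderMetric H) (c, t) (u, 0) (v, 0) (w, 0)).1
      = coordCurvature (fun y ↦ H (y, t)) c u v w - H (c, t) (A c v) w • A c u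
        + H (c, t) (A c u) w • A c v := by
  simp only [coordCurvature, Prod.fst_add, Prod.fst_sub, S.fderiv_christoffel_fst,
    S.eventually_christoffel.self_of_nhds]
  simp only [zero_smul, add_zero]
  module

/-- The Codazzi equation, with the covariant derivatives of the second fundamental form written out
in coordinates. -/
theorem coordCurvature_slice_snd (S : LocalCylinder c t H A) (u v w : E) :
    (coordCurvature (cylinderMetric H) (c, t) (u, 0) (v, 0) (w, 0)).2
      = fderiv ℝ (fun y ↦ H (y, t) (A y u) w) c v - fderiv ℝ (fun y ↦ H (y, t) (A y v) w) c u
        + H (c, t) (A c v) (christoffel (fun y ↦ H (y, t)) c u w)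
        - H (c, t) (A c u) (christoffel (fun y ↦ H (y, t)) c v w) := by
  simp only [coordCurvature, Prod.snd_add, Prod.snd_sub, S.fderiv_christoffel_snd,
    S.eventually_christoffel.self_of_nhds, zero_smul, add_zero]
  ring

/-- The Riccati equation. Both derivative terms vanish: $\nabla_u\partial_t=Au$ is constant in $t$,
and the $t$-lines are geodesics. What remains is $\nabla_{\partial_t}(Au)=A^2u$. -/
theorem coordCurvature_normal (S : LocalCylinder c t H A) (u : E) :
    coordCurvature (cylinderMetric H) (c, t) (0, 1) (u, 0) (0, 1) = (A c (A c u), 0) := by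
  have h1 : fderiv ℝ (fun z ↦ christoffel (cylinderMetric H) z (u, 0) (0, 1)) (c, t) (0, 1) = 0 := by
    rw [fderiv_prod_right (S.differentiableAt_christoffel _ _),
      EventuallyEq.fderiv_eq (f := fun _ ↦ (A c u, (0 : ℝ))), fderiv_const_apply]
    · rfl
    filter_upwards [(Continuous.prodMk_right c).continuousAt.eventually S.eventually_christoffel]
      with s hs
    simp [hs, christoffel_zero_right]
  have h2 : fderiv ℝ (fun z ↦ christoffel (cylinderMetric H) z (0, 1) (0, 1)) (c, t) (u, 0) = 0 := by
    rw [fderiv_prod_left (S.differentiableAt_christoffel _ _),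
      EventuallyEq.fderiv_eq (f := fun _ ↦ ((0 : E), (0 : ℝ))), fderiv_const_apply]
    · rfl
    filter_upwards [(Continuous.prodMk_left t).continuousAt.eventually S.eventually_christoffel]
      with s hs
    simp [hs, christoffel_zero_right]
  simp [coordCurvature, h1, h2, S.eventually_christoffel.self_of_nhds, christoffel_zero_right,
    christoffel_zero_left]

/-- Only $H(Av,Au)-H(Au,Av)$ survives. -/
theorem coordCurvature_slice_normal_snd (S : LocalCylinder c t H A)
    (hsymm : ∀ u v, H (c, t) u v = H (c, t) v u) (u v : E) :
    (coordCurvature (cylinderMetric H) (c, t) (u, 0) (v, 0) (0, 1)).2 = 0 := by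
  have h1 (u v : E) :
      (fderiv ℝ (fun z ↦ christoffel (cylinderMetric H) z (v, 0) (0, 1)) (c, t) (u, 0)).2 = 0 := by
    have hd := S.differentiableAt_christoffel (v, 0) (0, 1)
    have h := fderiv_prod_left hd.snd u
    rw [(hasFDerivAt_snd.comp (c, t) hd.hasFDerivAt).fderiv (f := fun z ↦ (_ : E × ℝ).2)] at h
    refine h.trans ((DFunLike.congr_fun (EventuallyEq.fderiv_eq (f := fun y ↦ (0 : ℝ))
      ?_) u).trans (by simp))
    filter_upwards [(Continuous.prodMk_left t).continuousAt.eventually S.eventually_christoffel]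
      with y hy
    simp [hy]
  simp [coordCurvature, h1, S.eventually_christoffel.self_of_nhds, christoffel_zero_right,
    hsymm (A c u)]

end LocalCylinder

end CylinderCalculus

/-! ### The four curvature formulas in coordinates. -/

section SymplectizationCalculus

open ContinuousLinearMap Filter
open scoped Topology

variable {E : Type*} [NormedAddCommGroup E] [NormedSpace ℝ E]

/-- The slice metrics of the metric symplectization in coordinates. -/
def coordSliceMetric (θ : E → E →L[ℝ] ℝ) (G : E → E →L[ℝ] E →L[ℝ] ℝ) (z : E × ℝ) :
    E →L[ℝ] E →L[ℝ] ℝ :=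
  Real.exp (2 * z.2) • G z.1 +
    (Real.exp (2 * z.2) * (Real.exp (2 * z.2) - 1)) • (θ z.1).smulRight (θ z.1)

/-- The shape operator of the slices of the metric symplectization in coordinates. -/
def coordShape (θ : E → E →L[ℝ] ℝ) (ζ : E → E) (y : E) : E →L[ℝ] E :=
  ContinuousLinearMap.id ℝ E + (θ y).smulRight (ζ y)

variable {c : E} {θ : E → E →L[ℝ] ℝ} {ζ : E → E}
  {G : E → E →L[ℝ] E →L[ℝ] ℝ} {φ : E → E →L[ℝ] E}

namespace LocalContactMetric

theorem slice [FiniteDimensional ℝ E] (S : LocalContactMetric c θ ζ G φ) (t : ℝ) :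
    LocalContactMetric c (fun y ↦ Real.exp (2 * t) • θ y) (fun y ↦ Real.exp (-(2 * t)) • ζ y)
      (fun y ↦ coordSliceMetric θ G (y, t)) φ := by
  rw [Real.exp_neg]
  -- The slice at height $t$ is the $D$-homothetic deformation with $a=e^{2t}$.
  exact S.deform (Real.exp_pos _)

theorem contDiffAt_coordSliceMetric (S : LocalContactMetric c θ ζ G φ) (t : ℝ) :
    ContDiffAt ℝ 2 (coordSliceMetric θ G) (c, t) := by
  have hθ : ContDiffAt ℝ 2 (fun z : E × ℝ ↦ θ z.1) (c, t) :=
    S.contDiffAt_form.comp (c, t) contDiffAt_fst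
  have hG : ContDiffAt ℝ 2 (fun z : E × ℝ ↦ G z.1) (c, t) :=
    S.contDiffAt_metric.comp (c, t) contDiffAt_fst
  have he : ContDiffAt ℝ 2 (fun z : E × ℝ ↦ Real.exp (2 * z.2)) (c, t) := by fun_prop
  exact (he.smul hG).add ((he.mul (he.sub contDiffAt_const)).smul (hθ.smulRight hθ))

/-- Since $g_t(\zeta,\cdot)=e^{4t}\theta$, the tensor $2g_t(A\cdot,\cdot)$ equals
$2e^{2t}g+(4e^{4t}-2e^{2t})\,\theta\otimes\theta$, which is $\partial_tg_t$. -/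
theorem localCylinder [FiniteDimensional ℝ E] (S : LocalContactMetric c θ ζ G φ) (t : ℝ) :
    LocalCylinder c t (coordSliceMetric θ G) (coordShape θ ζ) where
  contDiffAt := S.contDiffAt_coordSliceMetric t
  isInvertible := by
    filter_upwards [continuousAt_fst.eventually S.isInvertible,
      continuousAt_fst.eventually S.metric_reeb, continuousAt_fst.eventually S.form_reeb]
      with z h2 h3 h4
    exact isInvertible_deform (Real.exp_pos _) h2 h3 h4
  shape := by
    filter_upwards [continuousAt_fst.eventually S.symm, continuousAt_fst.eventually S.metric_reeb,
      continuousAt_fst.eventually S.form_reeb,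
      (S.contDiffAt_coordSliceMetric t).eventually (by simp)] with z h1 h2 h3 h4 u v
    have hd := h4.differentiableAt (by simp)
    rw [← fderiv_bilin_apply_const hd, fderiv_prod_right (c := z.1) (t := z.2)
      ((hd.clm_apply (differentiableAt_const u)).clm_apply (differentiableAt_const v))]
    have he : HasDerivAt (fun s : ℝ ↦ Real.exp (2 * s)) (Real.exp (2 * z.2) * 2) z.2 := by
      simpa using ((hasDerivAt_id z.2).const_mul 2).exp
    have hs := (he.mul_const (G z.1 u v)).add
      ((he.mul (he.sub_const 1)).mul_const (θ z.1 u * θ z.1 v))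
    have hs' := hs.congr_of_eventuallyEq (f₁ := fun s ↦ coordSliceMetric θ G (z.1, s) u v)
      (.of_forall fun s ↦ by simp [coordSliceMetric])
    rw [fderiv_apply_one_eq_deriv, hs'.deriv]
    have h5 : G z.1 (ζ z.1) v = θ z.1 v := by rw [h1, h2]
    simp only [coordSliceMetric, coordShape, add_apply, smul_apply, smulRight_apply, map_add,
      map_smul, id_apply, h3, h5, smul_eq_mul]
    ring

/-- Expresses the second fundamental form through the slice's own structure $(\theta_t,g_t)$, the
shape that `codazzi` requires. -/
theorem coordSliceMetric_shape (S : LocalContactMetric c θ ζ G φ) (t : ℝ) :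
    ∀ᶠ y in 𝓝 c, ∀ u w, coordSliceMetric θ G (y, t) (coordShape θ ζ y u) w
      = coordSliceMetric θ G (y, t) u w
        + (Real.exp (2 * t) • θ y) u * (Real.exp (2 * t) • θ y) w := by
  filter_upwards [S.symm, S.metric_reeb, S.form_reeb] with y h1 h2 h3 u w
  have h5 : G y (ζ y) w = θ y w := by rw [h1, h2]
  simp only [coordSliceMetric, coordShape, add_apply, smul_apply, smulRight_apply, map_add,
    map_smul, id_apply, h3, h5, smul_eq_mul]
  ring

/-- The Codazzi equation for the second fundamental form `G + θ ⊗ θ`. -/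
theorem codazzi [FiniteDimensional ℝ E] (S : LocalContactMetric c θ ζ G φ) (u v w : E) :
    fderiv ℝ (fun y ↦ G y u w + θ y u * θ y w) c v - fderiv ℝ (fun y ↦ G y v w + θ y v * θ y w) c u
        + (G c v (christoffel G c u w) + θ c v * θ c (christoffel G c u w))
        - (G c u (christoffel G c v w) + θ c u * θ c (christoffel G c v w))
      = -G c (φ c w) (θ c v • u - θ c u • v + θ c v • coordH ζ φ c u - θ c u • coordH ζ φ c v)
        + 2 * θ c w * G c v (φ c u) := by
  have := FiniteDimensional.complete ℝ E
  have hG := S.differentiableAt_metric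
  have hθ := S.differentiableAt_form
  have hd (p a b : E) : fderiv ℝ (fun y ↦ G y a b + θ y a * θ y b) c p
      = fderiv ℝ G c p a b + (fderiv ℝ θ c p a * θ c b + θ c a * fderiv ℝ θ c p b) := by
    have h1 (a : E) : DifferentiableAt ℝ (fun y ↦ θ y a) c := by fun_prop
    have h2 : DifferentiableAt ℝ (fun y ↦ G y a b) c := by fun_prop
    have h3 : DifferentiableAt ℝ (fun y ↦ θ y a * θ y b) c := (h1 a).mul (h1 b)
    rw [fderiv_fun_add h2 h3, add_apply, fderiv_bilin_apply_const hG,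
      fderiv_fun_mul (h1 a) (h1 b)]
    simp only [add_apply, smul_apply, fderiv_clm_apply_const hθ, smul_eq_mul]
    ring
  have hm := fderiv_metric_eq_christoffel hG S.isInvertible.self_of_nhds S.symm
  have hΓ := christoffel_symm hG S.symm u v
  have hN := S.covariantDeriv_form
  have hφ := S.metric_endo.self_of_nhds
  have hs := S.symm.self_of_nhds
  have hdη := S.fderiv_form.self_of_nhds v u
  have hmv := hm v u w
  rw [← hΓ] at hmv
  simp only [map_add, map_sub, map_smul, smul_eq_mul, hd]
  have e1 := hN u w
  have e2 := hN v w
  simp only [map_add, add_apply] at e1 e2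
  have f (a : E) : G c (φ c w) a = -G c (φ c a) w := by rw [hs, hφ]
  simp only [f]
  -- By $\nabla g=0$ and vanishing torsion all terms in `G` on the left cancel. In
  -- $\nabla(\theta\otimes\theta)$ the factor $\theta(w)$ multiplies $2\,d\theta(v,u)$, and the
  -- other terms contain $\nabla_u\theta$ and $\nabla_v\theta$ evaluated at $w$.
  linear_combination hmv - hm u v w - θ c v * e1 + θ c u * e2 + 2 * θ c w * hdη

theorem coordCurvature_slice_fst [FiniteDimensional ℝ E] (S : LocalContactMetric c θ ζ G φ) (t : ℝ) (u v w : E) :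
    (coordCurvature (cylinderMetric (coordSliceMetric θ G)) (c, t) (u, 0) (v, 0) (w, 0)).1
      = coordCurvature (fun y ↦ coordSliceMetric θ G (y, t)) c u v w
        + coordSliceMetric θ G (c, t) (u + (Real.exp (2 * t) • θ c) u •
            Real.exp (-(2 * t)) • ζ c) w • v
        - coordSliceMetric θ G (c, t) (v + (Real.exp (2 * t) • θ c) v •
            Real.exp (-(2 * t)) • ζ c) w • u
        + coordSliceMetric θ G (c, t) ((Real.exp (2 * t) • θ c) v • u
            - (Real.exp (2 * t) • θ c) u • v) w • Real.exp (-(2 * t)) • ζ c := by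
  have hA (u : E) : coordShape θ ζ c u
      = u + (Real.exp (2 * t) • θ c) u • Real.exp (-(2 * t)) • ζ c := by
    rw [smul_smul, smul_apply, smul_eq_mul, mul_right_comm, ← Real.exp_add]
    simp [coordShape]
  have hS := S.slice t
  have h1 : coordSliceMetric θ G (c, t) (Real.exp (-(2 * t)) • ζ c) w
      = (Real.exp (2 * t) • θ c) w := by
    rw [hS.symm.self_of_nhds, hS.metric_reeb.self_of_nhds]
  rw [(S.localCylinder t).coordCurvature_slice_fst, hA, hA]
  -- With $A=I+\theta'\otimes\zeta'$ in the Gauss equation, the two terms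
  -- $\theta'(u)\theta'(v)\theta'(w)\,\zeta'$ cancel; no other property of the exponentials is
  -- needed.
  generalize Real.exp (-(2 * t)) • ζ c = ζ' at *
  generalize Real.exp (2 * t) • θ c = θ' at *
  simp only [map_add, map_sub, map_smul, add_apply, sub_apply, smul_apply, h1, smul_eq_mul]
  module

theorem coordCurvature_slice_snd [FiniteDimensional ℝ E] (S : LocalContactMetric c θ ζ G φ) (t : ℝ) (u v w : E) :
    (coordCurvature (cylinderMetric (coordSliceMetric θ G)) (c, t) (u, 0) (v, 0) (w, 0)).2
      = -coordSliceMetric θ G (c, t) (φ c w)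
          ((Real.exp (2 * t) • θ c) v • u - (Real.exp (2 * t) • θ c) u • v
            + (Real.exp (2 * t) • θ c) v • coordH (fun y ↦ Real.exp (-(2 * t)) • ζ y) φ c u
            - (Real.exp (2 * t) • θ c) u • coordH (fun y ↦ Real.exp (-(2 * t)) • ζ y) φ c v)
        + 2 * (Real.exp (2 * t) • θ c) w * coordSliceMetric θ G (c, t) v (φ c u) := by
  have hA := S.coordSliceMetric_shape t
  have hd (u w : E) : fderiv ℝ (fun y ↦ coordSliceMetric θ G (y, t) (coordShape θ ζ y u) w) c
      = fderiv ℝ (fun y ↦ coordSliceMetric θ G (y, t) u w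
        + (Real.exp (2 * t) • θ y) u * (Real.exp (2 * t) • θ y) w) c :=
    EventuallyEq.fderiv_eq (hA.mono fun y hy ↦ hy u w)
  rw [(S.localCylinder t).coordCurvature_slice_snd, hd, hd, hA.self_of_nhds, hA.self_of_nhds]
  exact (S.slice t).codazzi u v w

theorem coordCurvature_normal [FiniteDimensional ℝ E] (S : LocalContactMetric c θ ζ G φ) (t : ℝ) (u v : E) :
    cylinderMetric (coordSliceMetric θ G) (c, t)
        (coordCurvature (cylinderMetric (coordSliceMetric θ G)) (c, t) (0, 1) (u, 0) (0, 1)) (v, 0)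
      = coordSliceMetric θ G (c, t) u v
        + 3 * (Real.exp (2 * t) • θ c) u * (Real.exp (2 * t) • θ c) v := by
  have hA := (S.coordSliceMetric_shape t).self_of_nhds
  -- The coefficient 3 is $1+2$: $g_t(A(Au),v)=g_t(Au,v)+\theta_t(Au)\theta_t(v)$, where the first
  -- term contributes one $\theta_t(u)\theta_t(v)$ and the second two.
  have hθ : θ c (coordShape θ ζ c u) = 2 * θ c u := by
    simp only [coordShape, add_apply, id_apply, smulRight_apply, map_add, map_smul,
      S.form_reeb.self_of_nhds, smul_eq_mul]
    ring
  rw [(S.localCylinder t).coordCurvature_normal, cylinderMetric_apply]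
  simp only [hA, smul_apply, hθ, smul_eq_mul]
  ring

theorem coordCurvature_slice_normal [FiniteDimensional ℝ E] (S : LocalContactMetric c θ ζ G φ) (t : ℝ) (u v : E) :
    cylinderMetric (coordSliceMetric θ G) (c, t)
      (coordCurvature (cylinderMetric (coordSliceMetric θ G)) (c, t) (u, 0) (v, 0) (0, 1)) (0, 1)
      = 0 := by
  rw [cylinderMetric_apply, (S.localCylinder t).coordCurvature_slice_normal_snd
    (S.slice t).symm.self_of_nhds]
  simp

end LocalContactMetric

end SymplectizationCalculus

/-! ### Coordinate expressions of tensor fields and change of charts. -/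

section ChartExpressions

open ContinuousLinearMap Filter
open scoped Topology

variable {E : Type*} [NormedAddCommGroup E] [NormedSpace ℝ E]
  {M : Type*} [TopologicalSpace M] [ChartedSpace E M]

theorem eventually_mem_extChartAt_target (x : M) :
    ∀ᶠ y in 𝓝 (extChartAt 𝓘(ℝ, E) x x), y ∈ (extChartAt 𝓘(ℝ, E) x).target :=
  (isOpen_extChartAt_target x).mem_nhds (mem_extChartAt_target x)

/-- `chartFrame`, with the tangent spaces of `M` identified with the model vector space. -/
def coordFrame (x : M) (y : E) : E →L[ℝ] E := chartFrame 𝓘(ℝ, E) x y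

theorem chartOneForm_eq (α : M → E →L[ℝ] ℝ) (x : M) (y : E) :
    chartOneForm 𝓘(ℝ, E) α x y
      = (α ((extChartAt 𝓘(ℝ, E) x).symm y)).comp (coordFrame x y) := rfl

theorem chartVectorField_eq (V : M → E) (x : M) (y : E) :
    chartVectorField 𝓘(ℝ, E) V x y
      = (coordFrame x y).inverse (V ((extChartAt 𝓘(ℝ, E) x).symm y)) := rfl

theorem chartEndo_eq (φ : M → E →L[ℝ] E) (x : M) (y : E) :
    chartEndo 𝓘(ℝ, E) φ x y = (coordFrame x y).inverse.comp
      ((φ ((extChartAt 𝓘(ℝ, E) x).symm y)).comp (coordFrame x y)) := rfl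

theorem chartBilin_eq (g : M → E →L[ℝ] E →L[ℝ] ℝ) (x : M) (y : E) :
    chartBilin 𝓘(ℝ, E) g x y
      = (g ((extChartAt 𝓘(ℝ, E) x).symm y)).bilinearComp (coordFrame x y) (coordFrame x y) := rfl

variable [IsManifold 𝓘(ℝ, E) ∞ M]

theorem isInvertible_coordFrame (x : M) {y : E} (hy : y ∈ (extChartAt 𝓘(ℝ, E) x).target) :
    (coordFrame x y).IsInvertible := by
  have : IsManifold 𝓘(ℝ, E) 1 M := .of_le (n := ∞) (by simp)
  have h := isInvertible_mfderivWithin_extChartAt_symm hy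
  rw [modelWithCornersSelf_coe, Set.range_id, mfderivWithin_univ] at h
  exact h

/-- Hence coordinate expressions at the center of the chart are the tensors themselves, and
identities proved there are identities at $x$. -/
theorem coordFrame_center (x : M) : coordFrame x (extChartAt 𝓘(ℝ, E) x x) = .id ℝ E :=
  ContinuousLinearMap.ext fun w ↦ ContactMetricStructure.chartFrame_center x w

theorem chartOneForm_center (α : M → E →L[ℝ] ℝ) (x : M) :
    chartOneForm 𝓘(ℝ, E) α x (extChartAt 𝓘(ℝ, E) x x) = α x := by
  refine (chartOneForm_eq α x _).trans ?_
  rw [coordFrame_center, extChartAt_to_inv, comp_id]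

theorem chartVectorField_center (V : M → E) (x : M) :
    chartVectorField 𝓘(ℝ, E) V x (extChartAt 𝓘(ℝ, E) x x) = V x := by
  refine (chartVectorField_eq V x _).trans ?_
  rw [coordFrame_center, extChartAt_to_inv, inverse_id, id_apply]

theorem chartEndo_center (φ : M → E →L[ℝ] E) (x : M) :
    chartEndo 𝓘(ℝ, E) φ x (extChartAt 𝓘(ℝ, E) x x) = φ x := by
  refine (chartEndo_eq φ x _).trans ?_
  rw [coordFrame_center, extChartAt_to_inv, inverse_id, comp_id, id_comp]

theorem chartBilin_center (g : M → E →L[ℝ] E →L[ℝ] ℝ) (x : M) :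
    chartBilin 𝓘(ℝ, E) g x (extChartAt 𝓘(ℝ, E) x x) = g x := by
  refine (chartBilin_eq g x _).trans ?_
  rw [coordFrame_center, extChartAt_to_inv]
  rfl

/-! ### Smoothness -/

/-- Bridge from bundle smoothness to smoothness of coordinate expressions. -/
theorem symmL_trivializationAt_eq_chartFrame (x : M) {y : E}
    (hy : y ∈ (extChartAt 𝓘(ℝ, E) x).target) :
    (trivializationAt E (TangentSpace 𝓘(ℝ, E)) x).symmL ℝ ((extChartAt 𝓘(ℝ, E) x).symm y)
      = chartFrame 𝓘(ℝ, E) x y := by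
  have : IsManifold 𝓘(ℝ, E) 1 M := .of_le (n := ∞) (by simp)
  have hs : (extChartAt 𝓘(ℝ, E) x).symm y ∈ (chartAt E x).source := by
    simpa using (extChartAt 𝓘(ℝ, E) x).map_target hy
  rw [TangentBundle.symmL_trivializationAt hs, modelWithCornersSelf_coe, Set.range_id,
    mfderivWithin_univ]
  rw [(extChartAt 𝓘(ℝ, E) x).right_inv hy]
  rfl

theorem contDiffAt_chartOneForm {α : (p : M) → TangentSpace 𝓘(ℝ, E) p →L[ℝ] ℝ} {x : M}
    (hα : ContMDiffAt 𝓘(ℝ, E) (𝓘(ℝ, E).prod 𝓘(ℝ, E →L[ℝ] ℝ)) ∞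
      (fun p ↦ Bundle.TotalSpace.mk' (E →L[ℝ] ℝ)
        (E := fun p : M ↦ TangentSpace 𝓘(ℝ, E) p →L[ℝ] ℝ) p (α p)) x) :
    ContDiffAt ℝ ∞ (chartOneForm 𝓘(ℝ, E) α x) (extChartAt 𝓘(ℝ, E) x x) := by
  rw [contMDiffAt_hom_bundle (E₂ := Bundle.Trivial M ℝ)] at hα
  have h := (hα.2.comp_of_eq (x := extChartAt 𝓘(ℝ, E) x x)
    ((contMDiffOn_extChartAt_symm (I := 𝓘(ℝ, E)) (n := ∞) x).contMDiffAt
      (eventually_mem_extChartAt_target x)) (by simp)).contDiffAt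
  refine h.congr_of_eventuallyEq ?_
  filter_upwards [eventually_mem_extChartAt_target x] with y hy
  ext w
  simp only [Function.comp_def, inCoordinates]
  rw [symmL_trivializationAt_eq_chartFrame x hy]
  simp [chartOneForm]

theorem contDiffAt_chartBilin
    {g : (p : M) → TangentSpace 𝓘(ℝ, E) p →L[ℝ] TangentSpace 𝓘(ℝ, E) p →L[ℝ] ℝ} {x : M}
    (hg : ContMDiffAt 𝓘(ℝ, E) (𝓘(ℝ, E).prod 𝓘(ℝ, E →L[ℝ] E →L[ℝ] ℝ)) ∞
      (fun p ↦ Bundle.TotalSpace.mk' (E →L[ℝ] E →L[ℝ] ℝ)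
        (E := fun p : M ↦ TangentSpace 𝓘(ℝ, E) p →L[ℝ] TangentSpace 𝓘(ℝ, E) p →L[ℝ] ℝ)
        p (g p)) x) :
    ContDiffAt ℝ ∞ (chartBilin 𝓘(ℝ, E) g x) (extChartAt 𝓘(ℝ, E) x x) := by
  rw [contMDiffAt_hom_bundle (E₂ := fun p : M ↦ TangentSpace 𝓘(ℝ, E) p →L[ℝ] Bundle.Trivial M ℝ p)]
    at hg
  have h := (hg.2.comp_of_eq (x := extChartAt 𝓘(ℝ, E) x x)
    ((contMDiffOn_extChartAt_symm (I := 𝓘(ℝ, E)) (n := ∞) x).contMDiffAt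
      (eventually_mem_extChartAt_target x)) (by simp)).contDiffAt
  refine h.congr_of_eventuallyEq ?_
  filter_upwards [eventually_mem_extChartAt_target x] with y hy
  ext w v
  simp only [Function.comp_def, inCoordinates]
  rw [symmL_trivializationAt_eq_chartFrame x hy]
  have hs : (extChartAt 𝓘(ℝ, E) x).symm y ∈ (chartAt E x).source := by
    simpa using (extChartAt 𝓘(ℝ, E) x).map_target hy
  -- The bundle of bilinear forms is a hom bundle with values in a hom bundle, so the trivialization
  -- is unfolded a second time.
  rw [comp_apply, Bundle.Trivialization.continuousLinearMapAt_apply,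
    Bundle.Trivialization.linearMapAt_apply, if_pos (by simpa using hs), hom_trivializationAt_apply]
  simp only [inCoordinates]
  rw [symmL_trivializationAt_eq_chartFrame x hy]
  simp [chartBilin]
  rfl

/-! ### The exterior derivative in an arbitrary chart -/

theorem contDiffAt_chartTransition (x : M) {y : E} (hy : y ∈ (extChartAt 𝓘(ℝ, E) x).target) :
    ContDiffAt ℝ ∞ (extChartAt 𝓘(ℝ, E) ((extChartAt 𝓘(ℝ, E) x).symm y) ∘
      (extChartAt 𝓘(ℝ, E) x).symm) y :=
  ((contMDiffAt_extChartAt (I := 𝓘(ℝ, E)) (n := ∞)).comp y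
    ((contMDiffOn_extChartAt_symm (I := 𝓘(ℝ, E)) (n := ∞) x).contMDiffAt
      ((isOpen_extChartAt_target x).mem_nhds hy))).contDiffAt

theorem coordFrame_transition (x p : M) {z : E} (hz : z ∈ (extChartAt 𝓘(ℝ, E) x).target)
    (hp : (extChartAt 𝓘(ℝ, E) x).symm z ∈ (extChartAt 𝓘(ℝ, E) p).source) :
    coordFrame x z
      = (coordFrame p (extChartAt 𝓘(ℝ, E) p ((extChartAt 𝓘(ℝ, E) x).symm z))).comp
        (fderiv ℝ (extChartAt 𝓘(ℝ, E) p ∘ (extChartAt 𝓘(ℝ, E) x).symm) z) := by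
  have h1 := (contMDiffOn_extChartAt_symm (I := 𝓘(ℝ, E)) (n := ∞) x).contMDiffAt
      ((isOpen_extChartAt_target x).mem_nhds hz)
  have h2 : MDifferentiableAt 𝓘(ℝ, E) 𝓘(ℝ, E)
      (extChartAt 𝓘(ℝ, E) p ∘ (extChartAt 𝓘(ℝ, E) x).symm) z :=
    ((contMDiffAt_extChartAt' (I := 𝓘(ℝ, E)) (n := ∞) (by simpa using hp)).comp z
      h1).mdifferentiableAt (by simp)
  have h3 : MDifferentiableAt 𝓘(ℝ, E) 𝓘(ℝ, E) (extChartAt 𝓘(ℝ, E) p).symm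
      ((extChartAt 𝓘(ℝ, E) p ∘ (extChartAt 𝓘(ℝ, E) x).symm) z) :=
    ((contMDiffOn_extChartAt_symm (I := 𝓘(ℝ, E)) (n := ∞) p).contMDiffAt
      ((isOpen_extChartAt_target p).mem_nhds
        ((extChartAt 𝓘(ℝ, E) p).map_source hp))).mdifferentiableAt (by simp)
  have h4 := mfderiv_comp z h3 h2
  rw [mfderiv_eq_fderiv] at h4
  refine Eq.trans ?_ h4
  refine EventuallyEq.mfderiv_eq ?_
  filter_upwards [h1.continuousAt.preimage_mem_nhds ((isOpen_extChartAt_source p).mem_nhds hp)]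
    with w hw
  exact ((extChartAt 𝓘(ℝ, E) p).left_inv hw).symm

/-- Naturality of $d$. The exterior derivative at $p$ is defined in the preferred chart of $p$,
whereas the local structure needs $d\eta$ at all points near $x$ in the single chart of $x$. The two
differ by $\alpha(D^2\tau(u,v))$ for the transition map $\tau$, which is symmetric and drops out. -/
theorem extDerivOneForm_chart {α : M → E →L[ℝ] ℝ} (x : M) {y : E}
    (hy : y ∈ (extChartAt 𝓘(ℝ, E) x).target)
    (hα : DifferentiableAt ℝ (chartOneForm 𝓘(ℝ, E) α ((extChartAt 𝓘(ℝ, E) x).symm y))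
      (extChartAt 𝓘(ℝ, E) ((extChartAt 𝓘(ℝ, E) x).symm y) ((extChartAt 𝓘(ℝ, E) x).symm y)))
    (u v : E) :
    (1 / 2) * (fderiv ℝ (chartOneForm 𝓘(ℝ, E) α x) y u v
        - fderiv ℝ (chartOneForm 𝓘(ℝ, E) α x) y v u)
      = extDerivOneForm 𝓘(ℝ, E) α ((extChartAt 𝓘(ℝ, E) x).symm y)
        (coordFrame x y u) (coordFrame x y v) := by
  set p := (extChartAt 𝓘(ℝ, E) x).symm y with hp
  set τ := extChartAt 𝓘(ℝ, E) p ∘ (extChartAt 𝓘(ℝ, E) x).symm with hτ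
  have hsmooth : ContDiffAt ℝ 2 τ y := (contDiffAt_chartTransition x hy).of_le ENat.LEInfty.out
  have hF : coordFrame x y = fderiv ℝ τ y := by
    rw [coordFrame_transition x p hy (mem_extChartAt_source p), coordFrame_center, id_comp]
  have hev : chartOneForm 𝓘(ℝ, E) α x
      =ᶠ[𝓝 y] fun z ↦ (chartOneForm 𝓘(ℝ, E) α p (τ z)).comp (fderiv ℝ τ z) := by
    have hc : ContinuousAt (extChartAt 𝓘(ℝ, E) x).symm y :=
      (continuousOn_extChartAt_symm x).continuousAt ((isOpen_extChartAt_target x).mem_nhds hy)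
    filter_upwards [(isOpen_extChartAt_target x).mem_nhds hy,
      hc.preimage_mem_nhds ((isOpen_extChartAt_source (I := 𝓘(ℝ, E)) p).mem_nhds
        (mem_extChartAt_source p))] with z hz hz'
    refine (chartOneForm_eq α x z).trans (Eq.trans ?_
      (congrArg (fun B : E →L[ℝ] ℝ ↦ B.comp (fderiv ℝ τ z)) (chartOneForm_eq α p (τ z))).symm)
    rw [coordFrame_transition x p hz hz', hτ, Function.comp_apply,
      (extChartAt 𝓘(ℝ, E) p).left_inv hz', comp_assoc]
  have hτ' : HasFDerivAt τ (fderiv ℝ τ y) y := (hsmooth.differentiableAt (by simp)).hasFDerivAt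
  have hτ'' : HasFDerivAt (fderiv ℝ τ) (fderiv ℝ (fderiv ℝ τ) y) y :=
    ((hsmooth.fderiv_right (m := 1) (by norm_num)).differentiableAt (by simp)).hasFDerivAt
  have hD := (((HasFDerivAt.comp y (g := chartOneForm 𝓘(ℝ, E) α p) hα.hasFDerivAt hτ').clm_comp
    hτ'').congr_of_eventuallyEq hev).fderiv
  have hsymm : fderiv ℝ (fderiv ℝ τ) y u v = fderiv ℝ (fderiv ℝ τ) y v u :=
    (hsmooth.isSymmSndFDerivAt (by simp)).eq u v
  rw [hD, hF]
  simp only [extDerivOneForm]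
  simp [hsymm]

end ChartExpressions

/-! ### Transfer from the manifold to coordinates. -/

namespace ContactMetricStructure

open ContinuousLinearMap Filter
open scoped Topology

variable {n : ℕ} {E : Type*} [NormedAddCommGroup E] [NormedSpace ℝ E]
  {M : Type*} [TopologicalSpace M] [ChartedSpace E M] [IsManifold 𝓘(ℝ, E) ∞ M]

theorem finiteDimensional (S : ContactMetricStructure n E M) : FiniteDimensional ℝ E :=
  Module.finite_of_finrank_pos (by rw [S.dim_eq]; omega)

/-- The algebraic axioms pass through the invertible frame pointwise; the two axioms on $d\eta$ use
`extDerivOneForm_chart`. -/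
theorem localContactMetric (S : ContactMetricStructure n E M) (x : M) :
    LocalContactMetric (extChartAt 𝓘(ℝ, E) x x) (chartOneForm 𝓘(ℝ, E) S.η x)
      (chartVectorField 𝓘(ℝ, E) S.ξ x) (chartBilin 𝓘(ℝ, E) S.g.inner x)
      (chartEndo 𝓘(ℝ, E) S.φ x) := by
  have := S.finiteDimensional
  set e := extChartAt 𝓘(ℝ, E) x with he
  let η : M → E →L[ℝ] ℝ := S.η
  let ξ : M → E := S.ξ
  let g : M → E →L[ℝ] E →L[ℝ] ℝ := S.g.inner
  let φ : M → E →L[ℝ] E := S.φ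
  have hη (y : E) : chartOneForm 𝓘(ℝ, E) S.η x y = (η (e.symm y)).comp (coordFrame x y) := rfl
  have hξ (y : E) :
      chartVectorField 𝓘(ℝ, E) S.ξ x y = (coordFrame x y).inverse (ξ (e.symm y)) := rfl
  have hg (y u v : E) : chartBilin 𝓘(ℝ, E) S.g.inner x y u v
      = g (e.symm y) (coordFrame x y u) (coordFrame x y v) := rfl
  have hφ (y u : E) : chartEndo 𝓘(ℝ, E) S.φ x y u
      = (coordFrame x y).inverse (φ (e.symm y) (coordFrame x y u)) := rfl
  have hgsymm (p : M) (u v : E) : g p u v = g p v u := S.g.symm p u v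
  have hgpos (p : M) (u : E) (hu : u ≠ 0) : 0 < g p u u := S.g.pos p u hu
  have hF (y : E) (hy : y ∈ e.target) : (coordFrame x y).IsInvertible :=
    isInvertible_coordFrame x hy
  have hdη (y : E) (hy : y ∈ e.target) (u v : E) :
      (1 / 2) * (fderiv ℝ (chartOneForm 𝓘(ℝ, E) S.η x) y u v
        - fderiv ℝ (chartOneForm 𝓘(ℝ, E) S.η x) y v u)
      = extDerivOneForm 𝓘(ℝ, E) S.η (e.symm y) (coordFrame x y u) (coordFrame x y v) :=
    extDerivOneForm_chart (α := η) x hy (S.differentiableAt_chartOneForm (e.symm y)) u v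
  have h2 : (2 : WithTop ℕ∞) ≤ ∞ := ENat.LEInfty.out
  have htarget : ∀ᶠ y in 𝓝 (e x), y ∈ e.target := eventually_mem_extChartAt_target x
  exact {
    contDiffAt_form := (contDiffAt_chartOneForm (S.smooth_η x)).of_le h2
    contDiffAt_metric := (contDiffAt_chartBilin (S.g.contMDiff x)).of_le h2
    symm := .of_forall fun y u v ↦ by rw [hg, hg, hgsymm]
    isInvertible := by
      filter_upwards [htarget] with y hy
      refine isInvertible_of_nondegenerate _ fun u hu ↦ ?_
      by_contra hne
      have hne' : coordFrame x y u ≠ 0 := fun h ↦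
        hne ((hF y hy).injective (by rw [h, map_zero]))
      exact (hgpos _ _ hne').ne' (hu u)
    form_reeb := by
      filter_upwards [htarget] with y hy
      rw [hη, hξ, comp_apply, (hF y hy).self_apply_inverse]
      exact S.η_ξ _
    fderiv_reeb := by
      filter_upwards [htarget] with y hy u
      have h := hdη y hy (chartVectorField 𝓘(ℝ, E) S.ξ x y) u
      rw [hξ, (hF y hy).self_apply_inverse] at h
      have h' := h.trans (S.dη_ξ _ _)
      rw [hξ]
      linarith
    metric_reeb := by
      filter_upwards [htarget] with y hy u
      rw [hη, hg, hξ, (hF y hy).self_apply_inverse]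
      exact S.g_ξ _ _
    endo_endo := by
      filter_upwards [htarget] with y hy u
      have h : φ (e.symm y) (φ (e.symm y) (coordFrame x y u))
        = -coordFrame x y u + η (e.symm y) (coordFrame x y u) • ξ (e.symm y) := S.φ_φ _ _
      rw [hφ, hφ, (hF y hy).self_apply_inverse, h, hη, hξ, map_add, map_neg, map_smul,
        (hF y hy).inverse_apply_self, comp_apply]
    fderiv_form := by
      filter_upwards [htarget] with y hy u v
      rw [hdη y hy, hg, hφ, (hF y hy).self_apply_inverse]
      exact S.dη_eq _ _ _ }

theorem chartBilin_sliceMetric (S : ContactMetricStructure n E M) (x : M) (t : ℝ) (y : E) :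
    chartBilin 𝓘(ℝ, E) (S.sliceMetric t) x y
      = coordSliceMetric (chartOneForm 𝓘(ℝ, E) S.η x) (chartBilin 𝓘(ℝ, E) S.g.inner x) (y, t) :=
  rfl

/-- The chart of $M\times\mathbb R$ is a product chart and its frame is the frame of $M$ times the
identity. Agreement near the center suffices, since curvature depends only on the germ of the
metric. -/
theorem chartBilin_sympMetric (S : ContactMetricStructure n E M) (x : M) (t : ℝ) :
    chartBilin (cylinderModel E) S.sympMetric ((x, t) : M × ℝ)
      =ᶠ[𝓝 (extChartAt 𝓘(ℝ, E) x x, t)]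
        cylinderMetric (coordSliceMetric (chartOneForm 𝓘(ℝ, E) S.η x)
          (chartBilin 𝓘(ℝ, E) S.g.inner x)) := by
  filter_upwards [continuousAt_fst.eventually (eventually_mem_extChartAt_target x)] with z hz
  obtain ⟨y, s⟩ := z
  have hs : (extChartAt (cylinderModel E) ((x, t) : M × ℝ)).symm (y, s)
      = ((extChartAt 𝓘(ℝ, E) x).symm y, s) := by
    rw [extChartAt_prod]; rfl
  have hF (p : E × ℝ) : (chartFrame (cylinderModel E) ((x, t) : M × ℝ) (y, s) p : E × ℝ)
      = (coordFrame x y p.1, p.2) := chartFrame_cylinder x t y hz s p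
  let G : M × ℝ → E × ℝ →L[ℝ] E × ℝ →L[ℝ] ℝ := S.sympMetric
  refine ContinuousLinearMap.ext fun p ↦ ContinuousLinearMap.ext fun q ↦ ?_
  have h : chartBilin (cylinderModel E) S.sympMetric ((x, t) : M × ℝ) (y, s) p q
      = G ((extChartAt (cylinderModel E) ((x, t) : M × ℝ)).symm (y, s))
        (chartFrame (cylinderModel E) ((x, t) : M × ℝ) (y, s) p : E × ℝ)
        (chartFrame (cylinderModel E) ((x, t) : M × ℝ) (y, s) q : E × ℝ) := rfl
  have hG : ∀ {z z' : M × ℝ} {p p' q q' : E × ℝ}, z = z' → p = p' → q = q' →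
      G z p q = G z' p' q' := by
    rintro _ _ _ _ _ _ rfl rfl rfl
    rfl
  refine h.trans ((hG hs (hF p) (hF q)).trans ?_)
  rw [cylinderMetric_apply]
  rfl

theorem sympCurvature_eq (S : ContactMetricStructure n E M) (x : M) (t : ℝ) (U V W : E × ℝ) :
    S.sympCurvature ((x, t) : M × ℝ) U V W
      = coordCurvature (cylinderMetric (coordSliceMetric (chartOneForm 𝓘(ℝ, E) S.η x)
          (chartBilin 𝓘(ℝ, E) S.g.inner x))) (extChartAt 𝓘(ℝ, E) x x, t) U V W := by
  have h : extChartAt (cylinderModel E) ((x, t) : M × ℝ) (x, t)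
      = (extChartAt 𝓘(ℝ, E) x x, t) := by
    rw [extChartAt_prod]; rfl
  rw [← coordCurvature_congr (S.chartBilin_sympMetric x t), ← h]
  rfl

theorem sliceH_eq (S : ContactMetricStructure n E M) (x : M) (t : ℝ) :
    coordH (fun y ↦ Real.exp (-(2 * t)) • chartVectorField 𝓘(ℝ, E) S.ξ x y)
      (chartEndo 𝓘(ℝ, E) S.φ x) (extChartAt 𝓘(ℝ, E) x x) = S.sliceH t x := by
  have hV : chartVectorField 𝓘(ℝ, E) (S.sliceReeb t) x
      = fun y ↦ Real.exp (-(2 * t)) • chartVectorField 𝓘(ℝ, E) S.ξ x y :=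
    funext fun y ↦ map_smul (coordFrame x y).inverse _ _
  have h1 := chartVectorField_center (M := M) S.ξ x
  have h2 := chartEndo_center (M := M) S.φ x
  funext u
  simp only [coordH, h1, h2, ← hV]
  rfl

theorem sliceMetric_eq (S : ContactMetricStructure n E M) (x : M) (t : ℝ) :
    coordSliceMetric (chartOneForm 𝓘(ℝ, E) S.η x) (chartBilin 𝓘(ℝ, E) S.g.inner x)
      (extChartAt 𝓘(ℝ, E) x x, t) = S.sliceMetric t x :=
  (S.chartBilin_sliceMetric x t _).symm.trans (chartBilin_center (M := M) (S.sliceMetric t) x)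

theorem sympMetric_eq (S : ContactMetricStructure n E M) (x : M) (t : ℝ) :
    cylinderMetric (coordSliceMetric (chartOneForm 𝓘(ℝ, E) S.η x)
      (chartBilin 𝓘(ℝ, E) S.g.inner x)) (extChartAt 𝓘(ℝ, E) x x, t)
      = S.sympMetric ((x, t) : M × ℝ) := by
  rw [cylinderMetric, sliceMetric_eq]
  rfl

end ContactMetricStructure

theorem theorem4p2 {n : ℕ} {E : Type*} [NormedAddCommGroup E] [NormedSpace ℝ E]
    {M : Type*} [TopologicalSpace M] [ChartedSpace E M] [IsManifold 𝓘(ℝ, E) ∞ M]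
    (S : ContactMetricStructure n E M) (x : M) (t : ℝ) (X Y Z : TangentSpace 𝓘(ℝ, E) x) :
    vert (x, t) (S.sympCurvature (x, t) (sliceLift x t X) (sliceLift x t Y) (sliceLift x t Z))
        = sliceLift x t
          (S.sliceCurvature t x X Y Z
            + S.sliceMetric t x (X + S.sliceForm t x X • S.sliceReeb t x) Z • Y
            - S.sliceMetric t x (Y + S.sliceForm t x Y • S.sliceReeb t x) Z • X
            + S.sliceMetric t x (S.sliceForm t x Y • X - S.sliceForm t x X • Y) Z
                • S.sliceReeb t x) ∧
    hor (x, t) (S.sympCurvature (x, t) (sliceLift x t X) (sliceLift x t Y) (sliceLift x t Z))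
        = (-S.sliceMetric t x (S.φ x Z)
              (S.sliceForm t x Y • X - S.sliceForm t x X • Y
                + S.sliceForm t x Y • S.sliceH t x X - S.sliceForm t x X • S.sliceH t x Y)
            + 2 * S.sliceForm t x Z * S.sliceMetric t x Y (S.φ x X)) • partialT (x, t) ∧
    S.sympMetric (x, t)
        (S.sympCurvature (x, t) (partialT (x, t)) (sliceLift x t X) (partialT (x, t))) (sliceLift x t Y)
        = S.sliceMetric t x X Y + 3 * S.sliceForm t x X * S.sliceForm t x Y ∧
    S.sympMetric (x, t)
        (S.sympCurvature (x, t) (sliceLift x t X) (sliceLift x t Y) (partialT (x, t))) (partialT (x, t))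
        = 0 := by
  have := S.finiteDimensional
  have hS := S.localContactMetric x
  have hη := chartOneForm_center (M := M) S.η x
  have hξ := chartVectorField_center (M := M) S.ξ x
  have hφ := chartEndo_center (M := M) S.φ x
  have hg := S.sliceMetric_eq x t
  have hgbar := S.sympMetric_eq x t
  refine ⟨?_, ?_, ?_, ?_⟩
  · have h := hS.coordCurvature_slice_fst t X Y Z
    rw [hη, hξ, hg] at h
    refine congrArg (fun u : E ↦ ((u, 0) : E × ℝ)) (Eq.trans ?_ h)
    exact congrArg Prod.fst (S.sympCurvature_eq x t (X, 0) (Y, 0) (Z, 0))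
  · have h := hS.coordCurvature_slice_snd t X Y Z
    rw [hη, hφ, hg, S.sliceH_eq] at h
    refine congrArg (fun a : ℝ ↦ a • ((0, 1) : E × ℝ)) (Eq.trans ?_ h)
    exact congrArg Prod.snd (S.sympCurvature_eq x t (X, 0) (Y, 0) (Z, 0))
  · have h := hS.coordCurvature_normal t X Y
    rw [hη, hg, hgbar, ← S.sympCurvature_eq] at h
    exact h
  · have h := hS.coordCurvature_slice_normal t X Y
    rw [hgbar, ← S.sympCurvature_eq] at h
    exact h

end
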